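/- **Theorem 1.6.** Let $O$ be the origin of $\mathbb{R}^2$, and let $G$ be a $C^\infty$ vector field on $\mathbb{R}^2$ that has property $(*)$ at $O$: there are a $C^\infty$ function $\eta:\mathbb{R}^2\to\mathbb{R}\setminus\{0\}$, $C^\infty$ local coordinates $(x,y)$ centred at $O$, and a real homogeneous polynomial $g(x,y)$ of degree at least $2$ without multiple prime factors in $\mathbb{R}[x,y]$, such that on the domain of these coordinates $$G=\eta H,\qquad H=(-g'_y,\,g'_x).$$ Let $\mathbf{G}(z,t)$ denote the (maximal) local flow of $G$, and define the following sets of germs at $O$. - $\hat{\mathcal E}(G,O)$ is the set of germs of $C^\infty$ diffeomorphisms $h:(\mathbb{R}^2,O)\to(\mathbb{R}^2,O)$ for which there is an open neighbourhood $V$ of $O$ with $h(\omega\cap V)\subset\omega$ for every orbit $\omega$ of $G$. - $\hat{\mathcal E}_{\mathrm{id}}(G,O)$, the identity component of $\hat{\mathcal E}(G,O)$ with respect to the $C^1$ topology, is the set of germs $h$ for which there are an open neighbourhood $V$ of $O$ and a family of $C^\infty$ maps $H_t:V\to\mathbb{R}^2$, $t\in[0,1]$, such that the germ of every $H_t$ at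 $O$ lies in $\hat{\mathcal E}(G,O)$, $H_t(\omega\cap V)\subset\omega$ for every $t$ and every orbit $\omega$ of $G$, $H_t(z)$ and its first order partial derivatives in $z$ are continuous in $(t,z)\in[0,1]\times V$, $H_0=\mathrm{id}_V$, and $H_1$ has germ $h$ at $O$. - $Sh(G,O)$ is the set of germs at $O$ of the maps $z\mapsto\mathbf{G}(z,\alpha(z))$, where $\alpha$ runs over all germs at $O$ of $C^\infty$ real-valued functions. Then $$Sh(G,O)=\hat{\mathcal E}_{\mathrm{id}}(G,O).$$ Thus for every $h\in\hat{\mathcal E}_{\mathrm{id}}(G,O)$ there is a $C^\infty$ function $\alpha:\mathbb{R}^2\to\mathbb{R}$ such that $h(z)=\mathbf{G}(z,\alpha(z))$ for all $z$ in some neighbourhood of $O$. -/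

import Mathlib

open Set Filter Topology
open scoped ContDiff

namespace ShiftGerms

/-- The plane `ℝ²`; the distinguished point `O` is the origin `0`. -/
abbrev Plane : Type := ℝ × ℝ

/-- The Hamiltonian vector field `(-∂g/∂y, ∂g/∂x)` of a polynomial `g` in two variables
(variable `0` is `x`, variable `1` is `y`). -/
noncomputable def hamiltonian (g : MvPolynomial (Fin 2) ℝ) (z : Plane) : Plane :=
  (-MvPolynomial.eval ![z.1, z.2] (MvPolynomial.pderiv 1 g),
    MvPolynomial.eval ![z.1, z.2] (MvPolynomial.pderiv 0 g))

/-- `e` is a `C^∞` diffeomorphism from an open neighbourhood of `O` onto an open neighbourhood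
of `O` that sends `O` to `O`. -/
structure IsSmoothLocalDiffeo (e : OpenPartialHomeomorph Plane Plane) : Prop where
  zero_mem : (0 : Plane) ∈ e.source
  map_zero : e 0 = 0
  smooth : ContDiffOn ℝ ∞ e e.source
  smooth_symm : ContDiffOn ℝ ∞ e.symm e.target

/-- Property `(*)` at `O` for a vector field `G`: in some local coordinates `e = (x, y)` at `O`
one has `G = η H`, where `η` is smooth and nowhere zero and `H` is the Hamiltonian vector field of
a homogeneous polynomial of degree at least `2` without multiple prime factors.  The left side of
the last equation is the expression of `G` in the coordinates `e`. -/
def HasPropertyStar (G : Plane → Plane) : Prop :=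
  ∃ (η : Plane → ℝ) (e : OpenPartialHomeomorph Plane Plane)
    (n : ℕ) (g : MvPolynomial (Fin 2) ℝ),
    ContDiff ℝ ∞ η ∧ (∀ z, η z ≠ 0) ∧
    IsSmoothLocalDiffeo e ∧
    2 ≤ n ∧ g.IsHomogeneous n ∧ Squarefree g ∧
    ∀ z ∈ e.source, fderiv ℝ e z (G z) = η z • hamiltonian g (e z)

/-- `FlowsTo G z t w` means that the (maximal) local flow of `G` is defined at `(z, t)` and has the
value `w` there: the solution of `γ' = G(γ)`, `γ(0) = z` exists from time `0` up to
time `t` (which may be negative), and `γ(t) = w`. -/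
def FlowsTo (G : Plane → Plane) (z : Plane) (t : ℝ) (w : Plane) : Prop :=
  ∃ γ : ℝ → Plane, γ 0 = z ∧ γ t = w ∧ IsIntegralCurveOn γ (fun _ => G) (uIcc 0 t)

/-- The orbit of `G` through `z`. -/
def orbit (G : Plane → Plane) (z : Plane) : Set Plane :=
  {w | ∃ t : ℝ, FlowsTo G z t w}

/-- `f (ω ∩ V) ⊆ ω` for every orbit `ω` of `G`. -/
def PreservesOrbitsOn (G : Plane → Plane) (f : Plane → Plane) (V : Set Plane) : Prop :=
  ∀ z, f '' (orbit G z ∩ V) ⊆ orbit G z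

/-- Germs at `O` of maps from the plane to itself. -/
abbrev MapGerm : Type := (𝓝 (0 : Plane)).Germ Plane

/-- Germs at `O` of `C^∞` diffeomorphisms `(ℝ², O) → (ℝ², O)` that preserve the orbits of `G`
on some neighbourhood of `O`. -/
def orbitPreservingGerms (G : Plane → Plane) : Set MapGerm :=
  {h | ∃ f : Plane → Plane, h = (f : MapGerm) ∧
    (∃ e : OpenPartialHomeomorph Plane Plane, IsSmoothLocalDiffeo e ∧ f =ᶠ[𝓝 0] e) ∧
    ∃ V : Set Plane, IsOpen V ∧ (0 : Plane) ∈ V ∧ PreservesOrbitsOn G f V}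

/-- The identity component of `orbitPreservingGerms G` with respect to the `C¹` topology: the
germs that can be joined to the identity by an isotopy `H t`, `t ∈ [0, 1]`, in
`orbitPreservingGerms G`, defined and orbit preserving on one neighbourhood `V` of `O`, such that
`H t z` and its first order derivatives in `z` depend continuously on `(t, z)`. -/
def identityComponent (G : Plane → Plane) : Set MapGerm :=
  {h | ∃ (V : Set Plane) (H : ℝ → Plane → Plane),
    IsOpen V ∧ (0 : Plane) ∈ V ∧
    (∀ t ∈ Icc (0 : ℝ) 1,
      (H t : MapGerm) ∈ orbitPreservingGerms G ∧
      ContDiffOn ℝ ∞ (H t) V ∧ PreservesOrbitsOn G (H t) V) ∧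
    ContinuousOn (fun q : ℝ × Plane => H q.1 q.2) (Icc (0 : ℝ) 1 ×ˢ V) ∧
    ContinuousOn (fun q : ℝ × Plane => fderiv ℝ (H q.1) q.2) (Icc (0 : ℝ) 1 ×ˢ V) ∧
    (∀ z ∈ V, H 0 z = z) ∧
    h = (H 1 : MapGerm)}

/-- Germs at `O` of the smooth shifts `z ↦ 𝐆(z, α(z))` along the orbits of `G`, where `𝐆` is the
local flow of `G` and `α` runs over all germs at `O` of smooth real functions. -/
def shiftGerms (G : Plane → Plane) : Set MapGerm :=
  {h | ∃ (f : Plane → Plane) (α : Plane → ℝ), h = (f : MapGerm) ∧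
    (∃ U : Set Plane, IsOpen U ∧ (0 : Plane) ∈ U ∧ ContDiffOn ℝ ∞ α U) ∧
    ∀ᶠ z in 𝓝 (0 : Plane), FlowsTo G z (α z) (f z)}

end ShiftGerms

/-!
The proof rests on two constructions.

Shifts are isotopic to the identity because the shift function can be multiplied by `t ∈ [0, 1]`.
This uses that the flow of a smooth field is smooth near an equilibrium, for any bounded range of
times (`exists_isSmoothFlow`).  For short times it follows from the inverse function theorem
applied to the integral equation `u = z + t ∫ G ∘ u` in `C([0, 1], ℝ²)`, on which composition with
a smooth map is smooth (`contDiff_continuousMap_comp`); longer times are reached by iteration.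

Conversely, let `H` be an isotopy along orbits, and work in the chart in which `G` is a multiple of
the Hamiltonian field of the form `g`.  An orbit meets the chart in countably many pieces of level
curves of `g`, so `g` is constant along the isotopy by continuity (`firstIntegral_isotopy`), and
the linear parts at `O` form a path of linear symmetries of `g` starting at the identity.  In degree
at least three the identity is isolated among these, so the linear part of the end of the isotopy is
the identity; in degree two it belongs to the flow of the Hamiltonian field, which is linear, and one
composes with its inverse.  This is the only place where the `C¹` topology matters.

It remains to treat a symmetry `k` of `g` tangent to the identity
(`exists_hamiltonian_path_of_tangent_to_id`).  Alexander's isotopy `k_t(z) = k(t z) / t` consists of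
symmetries of `g`, because `g` is homogeneous, and it is smooth up to `t = 0`, where it is the
identity.  Its velocity is annihilated by `dg`, and the division lemma
`exists_eq_smul_hamiltonian` shows that it is a smooth multiple of the Hamiltonian field.  Hence
each point moves along its trajectory, and the shift function is the integral over `t ∈ [0, 1]` of
the multiplier divided by `η`; it is smooth because it is an integral of a smooth function.

The division lemma is where the absence of multiple factors enters: the partial derivatives of `g`
then generate an ideal that contains a power of `y`, and they do not vanish together on the axis
`y = 0` outside `O`, so that Hadamard's lemma can be applied repeatedly.
-/

namespace ShiftGerms

/-! ### Composition operators on spaces of continuous functions -/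

/-- Pointwise evaluation of a continuous family of linear maps on a continuous family of vectors,
as a continuous bilinear map. -/
noncomputable def pointwiseApply (K : Type*) [TopologicalSpace K] [CompactSpace K]
    (E F : Type*) [NormedAddCommGroup E] [NormedSpace ℝ E] [NormedAddCommGroup F]
    [NormedSpace ℝ F] : C(K, E →L[ℝ] F) →L[ℝ] C(K, E) →L[ℝ] C(K, F) :=
  LinearMap.mkContinuous₂
    (LinearMap.mk₂ ℝ (fun (A : C(K, E →L[ℝ] F)) (u : C(K, E)) =>
        (⟨fun x => A x (u x), A.continuous.clm_apply u.continuous⟩ : C(K, F)))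
      (fun A B u => by ext x; simp) (fun c A u => by ext x; simp)
      (fun A u v => by ext x; simp) (fun c A u => by ext x; simp)) 1
    (fun A u => by
      rw [ContinuousMap.norm_le _ (by positivity)]
      intro x
      have h1 := A.norm_coe_le_norm x
      have h2 := u.norm_coe_le_norm x
      have h3 : ‖A x (u x)‖ ≤ ‖A x‖ * ‖u x‖ := (A x).le_opNorm _
      simp only [LinearMap.mk₂_apply, ContinuousMap.coe_mk, one_mul]
      exact h3.trans (by gcongr))

/-- Uniform continuity of `f'` near the compact image of `u` makes the remainder in the mean value
inequality uniform in the point of `K`. -/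
theorem hasFDerivAt_continuousMap_comp {K : Type*} [TopologicalSpace K] [CompactSpace K]
    {E F : Type*} [NormedAddCommGroup E] [NormedSpace ℝ E] [NormedAddCommGroup F]
    [NormedSpace ℝ F] (f : C(E, F)) (f' : C(E, E →L[ℝ] F))
    (hf : ∀ x, HasFDerivAt f (f' x) x) (u : C(K, E)) :
    HasFDerivAt (fun u : C(K, E) => f.comp u) (pointwiseApply K E F (f'.comp u)) u := by
  rw [hasFDerivAt_iff_isLittleO_nhds_zero, Asymptotics.isLittleO_iff]
  intro c hc
  have hcont := (ContinuousMap.continuous_postcomp (X := K) f').continuousAt (x := u)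
  obtain ⟨δ, hδ, h⟩ := Metric.continuousAt_iff (α := C(K, E))
    (β := C(K, E →L[ℝ] F)) |>.1 hcont c hc
  have key : ∀ x : K, ∀ y ∈ Metric.ball (u x) δ, ‖f' y - f' (u x)‖ ≤ c := by
    intro x y hy
    -- translate `u` by a constant so that it takes the value `y` at `x`
    have h1 : dist (u + ContinuousMap.const K (y - u x)) u < δ := by
      rw [dist_eq_norm, add_sub_cancel_left]
      refine lt_of_le_of_lt ((ContinuousMap.norm_le _ (norm_nonneg _)).2 fun _ => le_rfl) ?_
      rwa [Metric.mem_ball, dist_eq_norm] at hy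
    have h2 := (ContinuousMap.dist_apply_le_dist x).trans (h h1).le
    simpa only [dist_eq_norm, ContinuousMap.comp_apply,
      ContinuousMap.add_apply, ContinuousMap.const_apply, add_sub_cancel] using h2
  filter_upwards [Metric.ball_mem_nhds (0 : C(K, E)) hδ] with v hv
  rw [ContinuousMap.norm_le _ (by positivity)]
  intro x
  have hvx : ‖v x‖ < δ := (v.norm_coe_le_norm x).trans_lt (by simpa using hv)
  have := Convex.norm_image_sub_le_of_norm_hasFDerivWithin_le' (𝕜 := ℝ) (f := f) (C := c)
    (s := Metric.ball (u x) δ) (x := u x) (y := u x + v x) (f' := f') (φ := f' (u x))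
    (fun y _ => (hf y).hasFDerivWithinAt) (key x) (convex_ball _ _)
    (Metric.mem_ball_self hδ) (by simpa using hvx)
  simp only [add_sub_cancel_left] at this
  refine this.trans ?_
  gcongr
  exact v.norm_coe_le_norm x

universe u

theorem contDiff_nat_continuousMap_comp {K : Type*} [TopologicalSpace K] [CompactSpace K]
    {E : Type u} [NormedAddCommGroup E] [NormedSpace ℝ E] (n : ℕ) :
    ∀ {F : Type u} [NormedAddCommGroup F] [NormedSpace ℝ F] (f : C(E, F)),
      ContDiff ℝ ∞ f → ContDiff ℝ n (fun u : C(K, E) => f.comp u) := by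
  induction n with
  | zero =>
    intro F _ _ f _
    exact contDiff_zero.2 (ContinuousMap.continuous_postcomp f)
  | succ n ih =>
    intro F _ _ f hf
    have hf' : ContDiff ℝ ∞ (fderiv ℝ f) := hf.fderiv_right (m := ∞) (by simp)
    let f' : C(E, E →L[ℝ] F) := ⟨fderiv ℝ f, hf'.continuous⟩
    push_cast
    rw [contDiff_succ_iff_hasFDerivAt]
    refine ⟨fun u => pointwiseApply K E F (f'.comp u), ?_, fun u => ?_⟩
    · exact (pointwiseApply K E F).contDiff.comp (ih f' hf')
    · exact hasFDerivAt_continuousMap_comp f f'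
        (fun x => (hf.differentiable (by simp) x).hasFDerivAt) u

/-- Postcomposition with a smooth map is a smooth map between spaces of continuous functions on a
compact space. -/
theorem contDiff_continuousMap_comp {K : Type*} [TopologicalSpace K] [CompactSpace K]
    {E F : Type u} [NormedAddCommGroup E] [NormedSpace ℝ E] [NormedAddCommGroup F]
    [NormedSpace ℝ F] (f : C(E, F)) (hf : ContDiff ℝ ∞ f) :
    ContDiff ℝ ∞ (fun u : C(K, E) => f.comp u) :=
  contDiff_infty.2 fun n => contDiff_nat_continuousMap_comp n f hf

/-- The primitive vanishing at `0`, as a continuous linear operator on `C([0, 1], E)`. -/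
noncomputable def primitive (E : Type*) [NormedAddCommGroup E] [NormedSpace ℝ E]
    [CompleteSpace E] : C(Icc (0 : ℝ) 1, E) →L[ℝ] C(Icc (0 : ℝ) 1, E) :=
  LinearMap.mkContinuous
    { toFun := fun u => ⟨fun t => ∫ s in (0 : ℝ)..t, IccExtend zero_le_one u s,
        (intervalIntegral.continuous_primitive (fun _ _ =>
          (u.continuous.Icc_extend' (h := zero_le_one)).intervalIntegrable _ _) 0).comp
            continuous_subtype_val⟩
      map_add' := fun u v => by
        ext t
        simp only [ContinuousMap.coe_mk, ContinuousMap.add_apply]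
        rw [← intervalIntegral.integral_add
          ((u.continuous.Icc_extend' (h := zero_le_one)).intervalIntegrable _ _)
          ((v.continuous.Icc_extend' (h := zero_le_one)).intervalIntegrable _ _)]
        rfl
      map_smul' := fun c u => by
        ext t
        simp only [ContinuousMap.coe_mk, ContinuousMap.smul_apply, RingHom.id_apply]
        rw [← intervalIntegral.integral_smul]
        rfl } 1
    (fun u => by
      rw [ContinuousMap.norm_le _ (by positivity)]
      intro t
      have := intervalIntegral.norm_integral_le_of_norm_le_const (a := 0) (b := (t : ℝ))
        (f := IccExtend zero_le_one u) (C := ‖u‖) (fun s _ => u.norm_coe_le_norm _)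
      refine this.trans ?_
      rw [sub_zero, abs_of_nonneg t.2.1, one_mul]
      exact mul_le_of_le_one_right (norm_nonneg _) t.2.2)

theorem primitive_apply {E : Type*} [NormedAddCommGroup E] [NormedSpace ℝ E]
    [CompleteSpace E] (u : C(Icc (0 : ℝ) 1, E)) (t : Icc (0 : ℝ) 1) :
    primitive E u t = ∫ s in (0 : ℝ)..t, IccExtend zero_le_one u s := rfl

/-- The inclusion of constants into `C(K, E)`. -/
noncomputable def constCLM (K : Type*) [TopologicalSpace K] [CompactSpace K] (E : Type*)
    [NormedAddCommGroup E] [NormedSpace ℝ E] : E →L[ℝ] C(K, E) :=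
  LinearMap.mkContinuous
    { toFun := fun z => ContinuousMap.const K z
      map_add' := fun _ _ => rfl
      map_smul' := fun _ _ => rfl } 1 (fun z => by
        rw [ContinuousMap.norm_le _ (by positivity), one_mul]
        exact fun _ => le_rfl)

/-- The integral over `[0, 1]` of a smooth function depending smoothly on a parameter is smooth:
it is a continuous linear functional of the composition of that function with the curve
`s ↦ (s, z)`, which depends affinely on `z`. -/
theorem contDiff_integral_zero_one {E F : Type} [NormedAddCommGroup E] [NormedSpace ℝ E]
    [NormedAddCommGroup F] [NormedSpace ℝ F] [CompleteSpace F] {f : ℝ × E → F}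
    (hf : ContDiff ℝ ∞ f) : ContDiff ℝ ∞ (fun z => ∫ s in (0 : ℝ)..1, f (s, z)) := by
  let i0 : C(Icc (0 : ℝ) 1, ℝ × E) := ⟨fun s => ((s : ℝ), 0), by fun_prop⟩
  let i1 : E →L[ℝ] C(Icc (0 : ℝ) 1, ℝ × E) :=
    (constCLM (Icc (0 : ℝ) 1) (ℝ × E)).comp (ContinuousLinearMap.inr ℝ ℝ E)
  have h1 : ContDiff ℝ ∞ (fun z => i0 + i1 z) := contDiff_const.add i1.contDiff
  have h2 := (contDiff_continuousMap_comp (K := Icc (0 : ℝ) 1)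
    (⟨f, hf.continuous⟩ : C(ℝ × E, F)) hf).comp h1
  have h3 := ((ContinuousMap.evalCLM ℝ (⟨1, by simp⟩ : Icc (0 : ℝ) 1)).comp
    (primitive F)).contDiff (n := ∞) |>.comp h2
  convert h3 using 1
  ext z
  simp only [Function.comp, ContinuousLinearMap.comp_apply, ContinuousMap.evalCLM_apply,
    primitive_apply]
  refine intervalIntegral.integral_congr fun s hs => ?_
  rw [uIcc_of_le zero_le_one] at hs
  simp only [IccExtend_of_mem _ _ hs]
  change f (s, z) = f ((s, 0) + (0, z))
  simp

/-! ### The smooth inverse function theorem -/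

/-- A map that is smooth on a neighbourhood of a point where its derivative is invertible
restricts to a diffeomorphism between open sets. -/
theorem exists_smooth_openPartialHomeomorph {E F : Type*} [NormedAddCommGroup E]
    [NormedSpace ℝ E] [CompleteSpace E] [NormedAddCommGroup F] [NormedSpace ℝ F]
    {f : E → F} {U : Set E} (hU : IsOpen U) (hf : ContDiffOn ℝ ∞ f U) {a : E} (ha : a ∈ U)
    (f' : E ≃L[ℝ] F) (hf' : HasFDerivAt f (f' : E →L[ℝ] F) a) :
    ∃ e : OpenPartialHomeomorph E F, a ∈ e.source ∧ e.source ⊆ U ∧ (∀ z, e z = f z) ∧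
      ContDiffOn ℝ ∞ e e.source ∧ ContDiffOn ℝ ∞ e.symm e.target := by
  have hfa : ContDiffAt ℝ ∞ f a := hf.contDiffAt (hU.mem_nhds ha)
  have hs : HasStrictFDerivAt f (f' : E →L[ℝ] F) a := hfa.hasStrictFDerivAt' hf' (by simp)
  let e0 := hs.toOpenPartialHomeomorph f
  -- the derivative stays invertible nearby
  have hW0 : ContinuousOn (fderiv ℝ f) U := hf.continuousOn_fderiv_of_isOpen hU (by simp)
  obtain ⟨N, hN, hNo, hNa⟩ := mem_nhds_iff.1 (ContinuousLinearEquiv.nhds f')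
  let W := U ∩ fderiv ℝ f ⁻¹' N
  have hWo : IsOpen W := hW0.isOpen_inter_preimage hU hNo
  have haW : a ∈ W := ⟨ha, by simpa [hf'.fderiv] using hNa⟩
  let e := e0.restrOpen W hWo
  have hec : ∀ z, e z = f z := fun z => rfl
  have hsrc : e.source = e0.source ∩ W := e0.restrOpen_source W hWo
  refine ⟨e, ?_, ?_, hec, ?_, ?_⟩
  · rw [hsrc]; exact ⟨hs.mem_toOpenPartialHomeomorph_source, haW⟩
  · rw [hsrc]; exact fun z hz => hz.2.1
  · rw [hsrc]; exact hf.mono fun z hz => hz.2.1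
  · intro y hy
    have hz := e.map_target hy
    rw [hsrc] at hz
    obtain ⟨L, hL⟩ := hN hz.2.2
    have hcd : ContDiffAt ℝ ∞ f (e.symm y) := hf.contDiffAt (hU.mem_nhds hz.2.1)
    refine (e.contDiffAt_symm (f₀' := L) hy ?_ hcd).contDiffWithinAt
    rw [hL]
    exact (hcd.differentiableAt (by simp)).hasFDerivAt

/-- A function smooth on a neighbourhood of a point becomes globally smooth after multiplication
by a suitable cutoff function. -/
theorem exists_cutoff {E F : Type*} [NormedAddCommGroup E] [NormedSpace ℝ E]
    [FiniteDimensional ℝ E] [NormedAddCommGroup F] [NormedSpace ℝ F] {f : E → F} {U : Set E}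
    (hU : IsOpen U) (hf : ContDiffOn ℝ ∞ f U) {a : E} (ha : a ∈ U) :
    ∃ φ : E → ℝ, (∀ z ∉ U, φ z = 0) ∧ ContDiff ℝ ∞ (fun z => φ z • f z) ∧
      ∀ᶠ z in 𝓝 a, φ z = 1 := by
  obtain ⟨r, hr, hrU⟩ := Metric.isOpen_iff.1 hU a ha
  let φ : ContDiffBump a := ⟨r / 4, r / 2, by positivity, by linarith⟩
  have hts : tsupport φ ⊆ U := by
    rw [φ.tsupport_eq]
    exact (Metric.closedBall_subset_ball (by change r / 2 < r; linarith)).trans hrU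
  refine ⟨φ, fun z hz => image_eq_zero_of_notMem_tsupport fun h => hz (hts h), ?_,
    φ.eventuallyEq_one⟩
  rw [contDiff_iff_contDiffAt]
  intro z
  by_cases hz : z ∈ U
  · exact φ.contDiff.contDiffAt.smul (hf.contDiffAt (hU.mem_nhds hz))
  · have : (fun z => φ z • f z) =ᶠ[𝓝 z] fun _ => 0 := by
      filter_upwards [(isClosed_tsupport φ).isOpen_compl.mem_nhds fun h => hz (hts h)] with w hw
      rw [image_eq_zero_of_notMem_tsupport hw, zero_smul]
    exact contDiffAt_const.congr_of_eventuallyEq this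

theorem exists_contDiff_eventuallyEq {E F : Type*} [NormedAddCommGroup E] [NormedSpace ℝ E]
    [FiniteDimensional ℝ E] [NormedAddCommGroup F] [NormedSpace ℝ F] {f : E → F} {U : Set E}
    (hU : IsOpen U) (hf : ContDiffOn ℝ ∞ f U) {a : E} (ha : a ∈ U) :
    ∃ F' : E → F, ContDiff ℝ ∞ F' ∧ F' =ᶠ[𝓝 a] f := by
  obtain ⟨φ, -, hφ, h1⟩ := exists_cutoff hU hf ha
  exact ⟨_, hφ, h1.mono fun z hz => by simp [hz]⟩

/-! ### Uniqueness and composition of trajectories -/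

theorem hasDerivWithinAt_comp_time {c : ℝ → Plane} {c' : Plane} {f : ℝ → ℝ} {f' x : ℝ}
    {S T : Set ℝ} (hf : HasDerivWithinAt f f' T x) (hm : MapsTo f T S)
    (hc : HasDerivWithinAt c c' S (f x)) : HasDerivWithinAt (fun s => c (f s)) (f' • c') T x :=
  hc.scomp x hf hm

/-- Uniqueness for the time-dependent equation `f' = l(t) G(f)`: both solutions stay in a compact
ball, on which `G` is Lipschitz. -/
theorem eqOn_of_hasDerivWithinAt_smul {G : Plane → Plane} (hG : ContDiff ℝ ∞ G) {l : ℝ → ℝ}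
    {a b : ℝ} (hl : ContinuousOn l (Icc a b)) {f g : ℝ → Plane}
    (hf : ∀ t ∈ Icc a b, HasDerivWithinAt f (l t • G (f t)) (Icc a b) t)
    (hg : ∀ t ∈ Icc a b, HasDerivWithinAt g (l t • G (g t)) (Icc a b) t)
    (h0 : f a = g a) : EqOn f g (Icc a b) := by
  have hfc : ContinuousOn f (Icc a b) := fun t ht => (hf t ht).continuousWithinAt
  have hgc : ContinuousOn g (Icc a b) := fun t ht => (hg t ht).continuousWithinAt
  obtain ⟨R1, hR1⟩ := isCompact_Icc.exists_bound_of_continuousOn hfc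
  obtain ⟨R2, hR2⟩ := isCompact_Icc.exists_bound_of_continuousOn hgc
  obtain ⟨M, hM⟩ := isCompact_Icc.exists_bound_of_continuousOn hl
  have hball : IsCompact (Metric.closedBall (0 : Plane) (max R1 R2)) := isCompact_closedBall _ _
  obtain ⟨K, hK⟩ := hball.exists_bound_of_continuousOn
    ((hG.continuous_fderiv (by simp)).continuousOn)
  have hLip : LipschitzOnWith K.toNNReal G (Metric.closedBall (0 : Plane) (max R1 R2)) :=
    (convex_closedBall _ _).lipschitzOnWith_of_nnnorm_fderiv_le (𝕜 := ℝ)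
      (fun x _ => hG.differentiable (by simp) x) fun x hx => by
        rw [← NNReal.coe_le_coe]
        exact (hK x hx).trans (Real.le_coe_toNNReal K)
  have hnhds : ∀ t ∈ Ico a b, Icc a b ∈ 𝓝[Ici t] t := fun t ht => Icc_mem_nhdsGE_of_mem ht
  refine ODE_solution_unique_of_mem_Icc_right (v := fun t x => l t • G x)
    (s := fun _ => Metric.closedBall (0 : Plane) (max R1 R2)) (K := M.toNNReal * K.toNNReal)
    ?_ hfc ?_ ?_ hgc ?_ ?_ h0
  · intro t ht
    refine LipschitzOnWith.of_dist_le_mul fun x hx y hy => ?_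
    rw [dist_smul₀, NNReal.coe_mul, mul_assoc]
    have h1 : ‖l t‖ ≤ M.toNNReal := (hM t (Ico_subset_Icc_self ht)).trans (Real.le_coe_toNNReal M)
    have h2 := hLip.dist_le_mul x hx y hy
    gcongr
  · exact fun t ht => (hf t (Ico_subset_Icc_self ht)).mono_of_mem_nhdsWithin (hnhds t ht)
  · intro t ht
    simpa using Or.inl (hR1 t (Ico_subset_Icc_self ht))
  · exact fun t ht => (hg t (Ico_subset_Icc_self ht)).mono_of_mem_nhdsWithin (hnhds t ht)
  · intro t ht
    simpa using Or.inr (hR2 t (Ico_subset_Icc_self ht))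

/-- A trajectory can be rescaled to the time interval `[0, 1]`, whatever the sign of its
duration. -/
theorem flowsTo_iff {G : Plane → Plane} (hG : ContDiff ℝ ∞ G) {z w : Plane} {t : ℝ} :
    FlowsTo G z t w ↔ ∃ c : ℝ → Plane, c 0 = z ∧ c 1 = w ∧
      ∀ s ∈ Icc (0 : ℝ) 1, HasDerivWithinAt c (t • G (c s)) (Icc 0 1) s := by
  constructor
  · rintro ⟨γ, h0, h1, hγ⟩
    refine ⟨fun s => γ (s * t), by simpa using h0, by simpa using h1, fun s hs => ?_⟩
    have hm : MapsTo (fun s : ℝ => s * t) (Icc 0 1) (uIcc 0 t) := by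
      intro s hs
      rcases le_total 0 t with h | h
      · rw [uIcc_of_le h]; exact ⟨by have := hs.1; positivity, by nlinarith [hs.2]⟩
      · rw [uIcc_of_ge h]; exact ⟨by nlinarith [hs.2], by nlinarith [hs.1]⟩
    have hd : HasDerivWithinAt (fun s : ℝ => s * t) t (Icc 0 1) s := by
      simpa using (hasDerivWithinAt_id s (Icc (0 : ℝ) 1)).mul_const t
    exact (hγ _ (hm hs)).scomp s hd hm
  · rintro ⟨c, h0, h1, hc⟩
    rcases eq_or_ne t 0 with rfl | ht
    · have : EqOn c (fun _ => z) (Icc 0 1) :=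
        eqOn_of_hasDerivWithinAt_smul hG (l := fun _ => 0) continuousOn_const hc
          (fun s _ => by simpa using hasDerivWithinAt_const s (Icc (0 : ℝ) 1) z) h0
      have hz : w = z := by rw [← h1]; exact this (by simp)
      refine ⟨fun _ => z, rfl, hz.symm, fun s hs => ?_⟩
      rw [uIcc_self] at hs ⊢
      rw [mem_singleton_iff.1 hs]
      exact (HasFDerivWithinAt.of_subsingleton subsingleton_singleton)
    · refine ⟨fun s => c (s / t), by simpa using h0, by simpa [ht] using h1, fun s hs => ?_⟩
      have hm : MapsTo (fun s : ℝ => s / t) (uIcc 0 t) (Icc 0 1) := by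
        intro s hs
        rcases le_total 0 t with h | h
        · rw [uIcc_of_le h] at hs
          exact ⟨div_nonneg hs.1 h, div_le_one_of_le₀ hs.2 h⟩
        · rw [uIcc_of_ge h] at hs
          exact ⟨div_nonneg_of_nonpos hs.2 h, div_le_one_of_ge hs.1 h⟩
      have hd : HasDerivWithinAt (fun s : ℝ => s / t) (1 / t) (uIcc 0 t) s :=
        (hasDerivWithinAt_id s _).div_const t
      have := (hc _ (hm hs)).scomp s hd hm
      rwa [smul_smul, one_div_mul_cancel ht, one_smul] at this

section Trajectories

variable {G : Plane → Plane} {z w v : Plane} {s t : ℝ}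

theorem FlowsTo.unique (hG : ContDiff ℝ ∞ G) (h : FlowsTo G z t w) (h' : FlowsTo G z t v) :
    w = v := by
  obtain ⟨c, h0, h1, hc⟩ := (flowsTo_iff hG).1 h
  obtain ⟨d, k0, k1, hd⟩ := (flowsTo_iff hG).1 h'
  rw [← h1, ← k1]
  exact eqOn_of_hasDerivWithinAt_smul hG (l := fun _ => t) continuousOn_const hc hd
    (h0.trans k0.symm) (by simp)

theorem FlowsTo.zero (hG : ContDiff ℝ ∞ G) (z : Plane) : FlowsTo G z 0 z :=
  (flowsTo_iff hG).2 ⟨fun _ => z, rfl, rfl, fun s _ => by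
    simpa using hasDerivWithinAt_const s (Icc (0 : ℝ) 1) z⟩

theorem FlowsTo.neg (hG : ContDiff ℝ ∞ G) (h : FlowsTo G z t w) :
    FlowsTo (fun z => -G z) z (-t) w := by
  obtain ⟨c, h0, h1, hc⟩ := (flowsTo_iff hG).1 h
  exact (flowsTo_iff hG.neg).2 ⟨c, h0, h1, fun s hs => by simpa using hc s hs⟩

theorem FlowsTo.symm (hG : ContDiff ℝ ∞ G) (h : FlowsTo G z t w) : FlowsTo G w (-t) z := by
  obtain ⟨c, h0, h1, hc⟩ := (flowsTo_iff hG).1 h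
  refine (flowsTo_iff hG).2 ⟨fun s => c (1 - s), by simpa using h1, by simpa using h0,
    fun s hs => ?_⟩
  have hm : MapsTo (fun s : ℝ => 1 - s) (Icc 0 1) (Icc 0 1) := fun s hs =>
    ⟨by linarith [hs.2], by linarith [hs.1]⟩
  refine HasDerivWithinAt.congr_deriv
    (hasDerivWithinAt_comp_time
      ((hasDerivWithinAt_id s (Icc (0 : ℝ) 1)).const_sub 1) hm
    (hc _ (hm hs))) ?_
  simp

theorem FlowsTo.split (hG : ContDiff ℝ ∞ G) (h : FlowsTo G z t w) {θ : ℝ}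
    (hθ : θ ∈ Icc (0 : ℝ) 1) :
    ∃ u, FlowsTo G z (θ * t) u ∧ FlowsTo G u ((1 - θ) * t) w := by
  obtain ⟨c, h0, h1, hc⟩ := (flowsTo_iff hG).1 h
  refine ⟨c θ, (flowsTo_iff hG).2 ⟨fun s => c (s * θ), by simpa using h0, by simp,
    fun s hs => ?_⟩, (flowsTo_iff hG).2 ⟨fun s => c (θ + s * (1 - θ)), by simp,
      by simpa using h1, fun s hs => ?_⟩⟩
  · have hm : MapsTo (fun s : ℝ => s * θ) (Icc 0 1) (Icc 0 1) := fun s hs =>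
      ⟨mul_nonneg hs.1 hθ.1, mul_le_one₀ hs.2 hθ.1 hθ.2⟩
    refine HasDerivWithinAt.congr_deriv
      (hasDerivWithinAt_comp_time
        ((hasDerivWithinAt_id s (Icc (0 : ℝ) 1)).mul_const θ) hm (hc _ (hm hs))) ?_
    simp [smul_smul]
  · have hm : MapsTo (fun s : ℝ => θ + s * (1 - θ)) (Icc 0 1) (Icc 0 1) := fun s hs =>
      ⟨by nlinarith [hs.1, hθ.1, hθ.2], by nlinarith [hs.2, hθ.1, hθ.2]⟩
    refine HasDerivWithinAt.congr_deriv (hasDerivWithinAt_comp_time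
      (((hasDerivWithinAt_id s (Icc (0 : ℝ) 1)).mul_const (1 - θ)).const_add θ) hm
      (hc _ (hm hs))) ?_
    simp [smul_smul]

theorem FlowsTo.trans_nonneg (hs : 0 ≤ s) (ht : 0 ≤ t)
    (h : FlowsTo G z s w) (h' : FlowsTo G w t v) : FlowsTo G z (s + t) v := by
  obtain ⟨c, h0, h1, hc⟩ := h
  obtain ⟨d, k0, k1, hd⟩ := h'
  rw [uIcc_of_le hs] at hc
  rw [uIcc_of_le ht] at hd
  have hd' : IsIntegralCurveOn (fun τ => d (τ - s)) (fun _ => G) (Icc s (s + t)) := by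
    intro τ hτ
    have hm : MapsTo (fun τ : ℝ => τ - s) (Icc s (s + t)) (Icc 0 t) := fun τ hτ =>
      ⟨by linarith [hτ.1], by linarith [hτ.2]⟩
    refine HasDerivWithinAt.congr_deriv
      (hasDerivWithinAt_comp_time
        ((hasDerivWithinAt_id τ (Icc s (s + t))).sub_const s) hm (hd _ (hm hτ))) ?_
    simp
  let γ : ℝ → Plane := fun τ => if τ ≤ s then c τ else d (τ - s)
  have e1 : EqOn γ c (Icc 0 s) := fun τ hτ => if_pos hτ.2
  have e2 : EqOn γ (fun τ => d (τ - s)) (Icc s (s + t)) := fun τ hτ => by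
    rcases eq_or_lt_of_le hτ.1 with rfl | h
    · simp [γ, h1, k0]
    · exact if_neg h.not_ge
  have g1 : ∀ τ ∈ Icc 0 s, HasDerivWithinAt γ (G (γ τ)) (Icc 0 s) τ := fun τ hτ => by
    rw [e1 hτ]
    exact (hc τ hτ).congr e1 (e1 hτ)
  have g2 : ∀ τ ∈ Icc s (s + t), HasDerivWithinAt γ (G (γ τ)) (Icc s (s + t)) τ := fun τ hτ => by
    rw [e2 hτ]
    exact (hd' τ hτ).congr e2 (e2 hτ)
  refine ⟨γ, by rw [e1 ⟨le_rfl, hs⟩, h0], ?_, ?_⟩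
  · rw [e2 ⟨by linarith, le_rfl⟩]
    simpa using k1
  rw [uIcc_of_le (by positivity)]
  have hun : Icc 0 (s + t) = Icc 0 s ∪ Icc s (s + t) := (Icc_union_Icc_eq_Icc hs (by linarith)).symm
  intro τ hτ
  change HasDerivWithinAt γ (G (γ τ)) _ τ
  rw [hun]
  refine HasDerivWithinAt.union ?_ ?_
  · by_cases h : τ ∈ Icc 0 s
    · exact g1 τ h
    · exact HasFDerivWithinAt.of_notMem_closure (by rwa [isClosed_Icc.closure_eq])
  · by_cases h : τ ∈ Icc s (s + t)
    · exact g2 τ h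
    · exact HasFDerivWithinAt.of_notMem_closure (by rwa [isClosed_Icc.closure_eq])

theorem FlowsTo.trans_nonneg_nonpos (hG : ContDiff ℝ ∞ G) (hs : 0 ≤ s) (ht : t ≤ 0)
    (h : FlowsTo G z s w) (h' : FlowsTo G w t v) : FlowsTo G z (s + t) v := by
  rcases le_total 0 (s + t) with hst | hst
  · rcases eq_or_lt_of_le hs with rfl | hs
    · obtain rfl : t = 0 := by linarith
      rw [h.unique hG (FlowsTo.zero hG z)] at h'
      simpa using h'
    · obtain ⟨u, hu1, hu2⟩ := (h.symm hG).split hG (θ := -t / s)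
        ⟨div_nonneg (by linarith) hs.le, by rw [div_le_one hs]; linarith⟩
      have e1 : -t / s * -s = t := by field_simp
      rw [e1] at hu1
      rw [hu1.unique hG h'] at hu2
      convert hu2.symm hG using 1
      field_simp
      ring
  · rcases eq_or_lt_of_le ht with rfl | ht
    · rw [← (FlowsTo.zero hG w).unique hG h']
      simpa using h
    · obtain ⟨u, hu1, hu2⟩ := h'.split hG (θ := -s / t)
        ⟨div_nonneg_of_nonpos (by linarith) ht.le, by rw [div_le_one_of_neg ht]; linarith⟩
      have e1 : -s / t * t = -s := by field_simp [ht.ne]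
      rw [e1] at hu1
      rw [hu1.unique hG (h.symm hG)] at hu2
      convert hu2 using 1
      field_simp [ht.ne]
      ring

theorem FlowsTo.trans (hG : ContDiff ℝ ∞ G) (h : FlowsTo G z s w) (h' : FlowsTo G w t v) :
    FlowsTo G z (s + t) v := by
  have hneg : ∀ {x y : Plane} {r : ℝ}, FlowsTo (fun z => -G z) x (-r) y → FlowsTo G x r y :=
    fun h => by simpa using h.neg hG.neg
  rcases le_total 0 s with hs | hs <;> rcases le_total 0 t with ht | ht
  · exact h.trans_nonneg hs ht h'
  · exact h.trans_nonneg_nonpos hG hs ht h'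
  · apply hneg
    rw [neg_add]
    exact (h.neg hG).trans_nonneg_nonpos hG.neg (by linarith) (by linarith) (h'.neg hG)
  · apply hneg
    rw [neg_add]
    exact (h.neg hG).trans_nonneg (by linarith) (by linarith) (h'.neg hG)

theorem FlowsTo.const_of_eq_zero (hG : ContDiff ℝ ∞ G) (hz : G z = 0) (t : ℝ) :
    FlowsTo G z t z :=
  (flowsTo_iff hG).2 ⟨fun _ => z, rfl, rfl, fun s _ => by
    simpa [hz] using hasDerivWithinAt_const s (Icc (0 : ℝ) 1) z⟩

/-- A path with velocity `l t • G` runs along a trajectory of `G`, the elapsed time being the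
integral of `l`.  The function `l` may change sign, so one needs that the trajectory exists for
all intermediate times. -/
theorem flowsTo_integral (hG : ContDiff ℝ ∞ G) {l : ℝ → ℝ} (hl : Continuous l) {c : ℝ → Plane}
    (hc : ∀ s ∈ Icc (0 : ℝ) 1, HasDerivWithinAt c (l s • G (c s)) (Icc 0 1) s) {C : ℝ}
    (hC : ∀ s ∈ Icc (0 : ℝ) 1, |∫ r in (0 : ℝ)..s, l r| ≤ C)
    (h1 : FlowsTo G (c 0) C w) (h2 : FlowsTo G (c 0) (-C) v) :
    FlowsTo G (c 0) (∫ r in (0 : ℝ)..1, l r) (c 1) := by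
  have hC0 : 0 ≤ C := (abs_nonneg _).trans (hC 0 (by simp))
  have h3 : FlowsTo G v C (c 0) := by simpa using h2.symm hG
  obtain ⟨σ, hσ0, hσ1, hσ⟩ := h3.trans hG h1
  have hσC : σ C = c 0 := by
    refine FlowsTo.unique hG (z := v) (t := C) ⟨σ, hσ0, rfl, hσ.mono ?_⟩ h3
    rw [uIcc_of_le hC0, uIcc_of_le (by linarith)]
    exact Icc_subset_Icc_right (by linarith)
  rw [uIcc_of_le (by linarith)] at hσ
  let γ : ℝ → Plane := fun τ => σ (τ + C)
  have hγ : ∀ τ ∈ Icc (-C) C, HasDerivWithinAt γ (G (γ τ)) (Icc (-C) C) τ := by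
    intro τ hτ
    have hm : MapsTo (fun τ : ℝ => τ + C) (Icc (-C) C) (Icc 0 (C + C)) := fun τ hτ =>
      ⟨by linarith [hτ.1], by linarith [hτ.2]⟩
    refine HasDerivWithinAt.congr_deriv
      (hasDerivWithinAt_comp_time
        ((hasDerivWithinAt_id τ (Icc (-C) C)).add_const C) hm (hσ _ (hm hτ))) ?_
    simp [γ]
  have hγ0 : γ 0 = c 0 := by simpa [γ] using hσC
  have hm : MapsTo (fun s => ∫ r in (0 : ℝ)..s, l r) (Icc 0 1) (Icc (-C) C) := fun s hs =>
    abs_le.1 (hC s hs)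
  have heq : EqOn c (fun s => γ (∫ r in (0 : ℝ)..s, l r)) (Icc 0 1) := by
    refine eqOn_of_hasDerivWithinAt_smul hG hl.continuousOn hc (fun s hs => ?_) (by simp [hγ0])
    exact hasDerivWithinAt_comp_time (hl.integral_hasStrictDerivAt 0 s).hasDerivAt.hasDerivWithinAt
      hm (hγ _ (hm hs))
  refine ⟨γ, hγ0, (heq (by simp)).symm, fun τ hτ => ?_⟩
  have hsub : uIcc 0 (∫ r in (0 : ℝ)..1, l r) ⊆ Icc (-C) C :=
    ordConnected_Icc.uIcc_subset ⟨by linarith, hC0⟩ (hm (by simp))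
  exact (hγ τ (hsub hτ)).mono hsub

end Trajectories

/-! ### Smooth dependence of the flow on time and initial point -/

/-- `Γ` is the flow of `G` on times `|t| < C` and initial points `‖z‖ < ρ`, and is smooth
there. -/
structure IsSmoothFlow (G : Plane → Plane) (C ρ : ℝ) (Γ : ℝ × Plane → Plane) : Prop where
  contDiffOn : ContDiffOn ℝ ∞ Γ (Ioo (-C) C ×ˢ Metric.ball 0 ρ)
  flowsTo : ∀ t ∈ Ioo (-C) C, ∀ z ∈ Metric.ball (0 : Plane) ρ, FlowsTo G z t (Γ (t, z))

theorem isOpen_timeBall (C ρ : ℝ) :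
    IsOpen (Ioo (-C) C ×ˢ Metric.ball (0 : Plane) ρ) := isOpen_Ioo.prod Metric.isOpen_ball

/-- Near an equilibrium the flow exists and is smooth for short times.  The trajectory rescaled to
`[0, 1]` solves `u = z + t ∫ G ∘ u` in the Banach space `C([0, 1], ℝ²)`; at `u = 0`, `z = 0`,
`t = 0` the linearization of this equation in `u` is the identity, and the inverse function
theorem applies. -/
theorem exists_isSmoothFlow_short {G : Plane → Plane} (hG : ContDiff ℝ ∞ G) (hG0 : G 0 = 0) :
    ∃ C > 0, ∃ ρ > 0, ∃ Γ, IsSmoothFlow G C ρ Γ := by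
  let X := C(Icc (0 : ℝ) 1, Plane)
  let Gc : C(Plane, Plane) := ⟨G, hG.continuous⟩
  let k : Plane →L[ℝ] X := constCLM (Icc (0 : ℝ) 1) Plane
  let N : X → X := fun u => primitive Plane (Gc.comp u)
  have hN : ContDiff ℝ ∞ N := (primitive Plane).contDiff.comp (contDiff_continuousMap_comp Gc hG)
  have hN0 : N 0 = 0 := by
    have : Gc.comp (0 : X) = 0 := by ext1 t; exact hG0
    simp [N, this]
  let Ψ : X × (ℝ × Plane) → X × (ℝ × Plane) := fun p => (p.1 - k p.2.2 - p.2.1 • N p.1, p.2)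
  have hΨ : ContDiff ℝ ∞ Ψ := by
    refine ContDiff.prodMk ?_ contDiff_snd
    refine (contDiff_fst.sub (k.contDiff.comp (contDiff_snd.comp contDiff_snd))).sub ?_
    exact (contDiff_fst.comp contDiff_snd).smul (hN.comp contDiff_fst)
  let q : X × (ℝ × Plane) →L[ℝ] X :=
    k.comp ((ContinuousLinearMap.snd ℝ ℝ Plane).comp (ContinuousLinearMap.snd ℝ X (ℝ × Plane)))
  let fs := ContinuousLinearMap.fst ℝ X (ℝ × Plane)
  let sn := ContinuousLinearMap.snd ℝ X (ℝ × Plane)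
  let L : (X × (ℝ × Plane)) ≃L[ℝ] (X × (ℝ × Plane)) :=
    ContinuousLinearEquiv.equivOfInverse ((fs - q).prod sn) ((fs + q).prod sn)
      (fun p => by simp [fs, sn, q]) (fun p => by simp [fs, sn, q])
  have hL : HasFDerivAt Ψ (L : (X × (ℝ × Plane)) →L[ℝ] (X × (ℝ × Plane))) 0 := by
    have h1 : HasFDerivAt (fun p : X × (ℝ × Plane) => p.2.1 • N p.1)
        (0 : X × (ℝ × Plane) →L[ℝ] X) 0 := by
      have a1 : HasFDerivAt (fun p : X × (ℝ × Plane) => p.2.1)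
        ((ContinuousLinearMap.fst ℝ ℝ Plane).comp sn) 0 :=
        ((ContinuousLinearMap.fst ℝ ℝ Plane).comp sn).hasFDerivAt
      have a2 : HasFDerivAt (fun p : X × (ℝ × Plane) => N p.1)
          ((fderiv ℝ N 0).comp fs) 0 :=
        (hN.differentiable (by simp) (fs 0)).hasFDerivAt.comp (0 : X × (ℝ × Plane)) fs.hasFDerivAt
      refine (a1.smul a2).congr_fderiv ?_
      ext p <;> simp [hN0]
    have h2 : HasFDerivAt (fun p : X × (ℝ × Plane) => p.1 - k p.2.2) (fs - q) 0 :=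
      (fs - q).hasFDerivAt
    refine ((h2.sub h1).prodMk sn.hasFDerivAt).congr_fderiv ?_
    rw [sub_zero]
    rfl
  obtain ⟨e, he0, -, hec, -, hes⟩ := exists_smooth_openPartialHomeomorph isOpen_univ
    hΨ.contDiffOn (mem_univ 0) L hL
  have he00 : e 0 = 0 := by rw [hec]; simp [Ψ, hN0]
  have hi : ContDiff ℝ ∞ (fun y : ℝ × Plane => ((0 : X), y)) := contDiff_prodMk_right 0
  have hopen : IsOpen ((fun y : ℝ × Plane => ((0 : X), y)) ⁻¹' e.target) :=
    e.open_target.preimage hi.continuous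
  have hmem : (0 : ℝ × Plane) ∈ (fun y : ℝ × Plane => ((0 : X), y)) ⁻¹' e.target := by
    have := e.map_source he0
    rwa [he00] at this
  obtain ⟨r, hr, hrb⟩ := Metric.isOpen_iff.1 hopen 0 hmem
  have hsub : Ioo (-r) r ×ˢ Metric.ball (0 : Plane) r ⊆
      (fun y : ℝ × Plane => ((0 : X), y)) ⁻¹' e.target := by
    refine Subset.trans ?_ hrb
    rintro ⟨t, z⟩ ⟨ht, hz⟩
    simp only [mem_ball_zero_iff, Prod.norm_def, sup_lt_iff] at hz ⊢
    exact ⟨abs_lt.2 ht, hz⟩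
  let γ : ℝ × Plane → X := fun y => (e.symm (0, y)).1
  refine ⟨r, hr, r, hr, fun y => γ y ⟨1, by simp⟩, ?_, ?_⟩
  · have h1 : ContDiffOn ℝ ∞ γ (Ioo (-r) r ×ˢ Metric.ball (0 : Plane) r) :=
      contDiff_fst.comp_contDiffOn (hes.comp hi.contDiffOn hsub)
    exact (ContinuousMap.evalCLM ℝ (⟨1, by simp⟩ : Icc (0 : ℝ) 1)).contDiff.comp_contDiffOn h1
  · intro t ht z hz
    have h1 : Ψ (e.symm (0, (t, z))) = (0, (t, z)) := by
      rw [← hec]; exact e.right_inv (hsub ⟨ht, hz⟩)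
    have h2 : (e.symm (0, (t, z))).2 = (t, z) := congrArg Prod.snd h1
    have h3 : γ (t, z) - k z - t • N (γ (t, z)) = 0 := by
      have := congrArg Prod.fst h1
      simp only [Ψ, h2] at this
      exact this
    set u := γ (t, z) with hu
    let w : ℝ → Plane := IccExtend zero_le_one (Gc.comp u)
    have hw : Continuous w := (Gc.comp u).continuous.Icc_extend' (h := zero_le_one)
    have h4 : ∀ s : Icc (0 : ℝ) 1, u s = z + t • ∫ τ in (0 : ℝ)..s, w τ := by
      intro s
      have : u s - z - t • primitive Plane (Gc.comp u) s = 0 := congrArg (fun v : X => v s) h3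
      rwa [sub_sub, sub_eq_zero, primitive_apply] at this
    refine (flowsTo_iff hG).2 ⟨fun s => z + t • ∫ τ in (0 : ℝ)..s, w τ, by simp,
      (h4 ⟨1, by simp⟩).symm, fun s hs => ?_⟩
    have h5 : w s = G (z + t • ∫ τ in (0 : ℝ)..s, w τ) := by
      rw [← h4 ⟨s, hs⟩]
      exact IccExtend_of_mem _ _ hs
    have h6 := ((hw.integral_hasStrictDerivAt 0 s).hasDerivAt.const_smul t).const_add z
    rw [h5] at h6
    exact h6.hasDerivWithinAt

/-- Iterating the flow once lengthens the time interval on which it is defined. -/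
theorem IsSmoothFlow.extend {G : Plane → Plane} (hG : ContDiff ℝ ∞ G) (hG0 : G 0 = 0) {C ρ : ℝ}
    {Γ : ℝ × Plane → Plane} (hC : 0 < C) (hρ : 0 < ρ) (h : IsSmoothFlow G C ρ Γ) :
    ∃ ρ' > 0, ∃ Γ', IsSmoothFlow G (3 / 2 * C) ρ' Γ' := by
  have hΓ0 : ∀ t ∈ Ioo (-C) C, Γ (t, 0) = 0 := fun t ht =>
    (h.flowsTo t ht 0 (Metric.mem_ball_self hρ)).unique hG (FlowsTo.const_of_eq_zero hG hG0 t)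
  have hopen : IsOpen ((Ioo (-C) C ×ˢ Metric.ball (0 : Plane) ρ) ∩ Γ ⁻¹' Metric.ball 0 ρ) :=
    h.contDiffOn.continuousOn.isOpen_inter_preimage (isOpen_timeBall C ρ) Metric.isOpen_ball
  obtain ⟨A, B, -, hB, hA', hB0, hAB⟩ := generalized_tube_lemma
    (isCompact_Icc (a := -(3 / 4 * C)) (b := 3 / 4 * C)) (isCompact_singleton (x := (0 : Plane)))
    hopen (by
      rintro ⟨t, z⟩ ⟨ht, hz⟩
      rw [mem_singleton_iff] at hz
      have ht' : t ∈ Ioo (-C) C := ⟨by linarith [ht.1], by linarith [ht.2]⟩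
      simp only at hz
      subst hz
      refine ⟨⟨ht', Metric.mem_ball_self hρ⟩, ?_⟩
      simp only [mem_preimage]
      rw [hΓ0 t ht']
      exact Metric.mem_ball_self hρ)
  obtain ⟨ρ', hρ', hball⟩ := Metric.isOpen_iff.1 hB 0 (hB0 rfl)
  have hin : ∀ t ∈ Ioo (-(3 / 2 * C)) (3 / 2 * C), ∀ z ∈ Metric.ball (0 : Plane) ρ',
      (t / 2, z) ∈ (Ioo (-C) C ×ˢ Metric.ball (0 : Plane) ρ) ∩ Γ ⁻¹' Metric.ball 0 ρ :=
    fun t ht z hz => hAB ⟨hA' ⟨by linarith [ht.1], by linarith [ht.2]⟩, hball hz⟩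
  refine ⟨ρ', hρ', fun y => Γ (y.1 / 2, Γ (y.1 / 2, y.2)), ?_, ?_⟩
  · have h1 : ContDiff ℝ ∞ (fun y : ℝ × Plane => (y.1 / 2, y.2)) := by fun_prop
    have h2 := h.contDiffOn.comp h1.contDiffOn
      (s := Ioo (-(3 / 2 * C)) (3 / 2 * C) ×ˢ Metric.ball (0 : Plane) ρ')
      fun y hy => (hin y.1 hy.1 y.2 hy.2).1
    have h3 : ContDiff ℝ ∞ (fun y : ℝ × Plane => y.1 / 2) := by fun_prop
    exact h.contDiffOn.comp (h3.contDiffOn.prodMk h2)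
      fun y hy => ⟨(hin y.1 hy.1 y.2 hy.2).1.1, (hin y.1 hy.1 y.2 hy.2).2⟩
  · intro t ht z hz
    have h1 := hin t ht z hz
    have h2 := (h.flowsTo (t / 2) h1.1.1 z h1.1.2).trans hG
      (h.flowsTo (t / 2) h1.1.1 _ h1.2)
    simpa using h2

/-- Near an equilibrium the flow exists and is smooth for any prescribed bounded set of times. -/
theorem exists_isSmoothFlow {G : Plane → Plane} (hG : ContDiff ℝ ∞ G) (hG0 : G 0 = 0) (C : ℝ) :
    ∃ ρ > 0, ∃ Γ, IsSmoothFlow G C ρ Γ := by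
  obtain ⟨C0, hC0, ρ0, hρ0, Γ0, h0⟩ := exists_isSmoothFlow_short hG hG0
  have hn : ∀ n : ℕ, ∃ ρ > 0, ∃ Γ, IsSmoothFlow G ((3 / 2) ^ n * C0) ρ Γ := by
    intro n
    induction n with
    | zero => exact ⟨ρ0, hρ0, Γ0, by simpa using h0⟩
    | succ n ih =>
      obtain ⟨ρ, hρ, Γ, h⟩ := ih
      rw [pow_succ', mul_assoc]
      exact h.extend hG hG0 (by positivity) hρ
  obtain ⟨n, hn'⟩ := pow_unbounded_of_one_lt (C / C0) (by norm_num : (1 : ℝ) < 3 / 2)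
  obtain ⟨ρ, hρ, Γ, h⟩ := hn n
  have hle : C ≤ (3 / 2) ^ n * C0 := by rw [← div_le_iff₀ hC0]; exact hn'.le
  have hsub : Ioo (-C) C ⊆ Ioo (-((3 / 2) ^ n * C0)) ((3 / 2) ^ n * C0) :=
    Ioo_subset_Ioo (by linarith) hle
  exact ⟨ρ, hρ, Γ, h.contDiffOn.mono (prod_mono hsub Subset.rfl), fun t ht => h.flowsTo t (hsub ht)⟩

/-! ### Shifts along trajectories are isotopic to the identity -/

theorem IsSmoothFlow.apply_zero {G : Plane → Plane} {C ρ : ℝ} {Γ : ℝ × Plane → Plane}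
    (h : IsSmoothFlow G C ρ Γ) (hG : ContDiff ℝ ∞ G) (hG0 : G 0 = 0) (hρ : 0 < ρ) {t : ℝ}
    (ht : t ∈ Ioo (-C) C) : Γ (t, 0) = 0 :=
  (h.flowsTo t ht 0 (Metric.mem_ball_self hρ)).unique hG (FlowsTo.const_of_eq_zero hG hG0 t)

theorem IsSmoothFlow.hasFDerivAt_slice {G : Plane → Plane} {C ρ : ℝ} {Γ : ℝ × Plane → Plane}
    (h : IsSmoothFlow G C ρ Γ) (hρ : 0 < ρ) {t : ℝ} (ht : t ∈ Ioo (-C) C) :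
    HasFDerivAt Γ (fderiv ℝ Γ (t, 0)) (t, 0) :=
  ((h.contDiffOn.contDiffAt ((isOpen_timeBall C ρ).mem_nhds
    ⟨ht, Metric.mem_ball_self hρ⟩)).differentiableAt (by simp)).hasFDerivAt

/-- The derivative at the equilibrium of the time `t` map is inverse to that of the time `-t`
map. -/
theorem IsSmoothFlow.comp_fderiv {G : Plane → Plane} {C ρ : ℝ} {Γ : ℝ × Plane → Plane}
    (h : IsSmoothFlow G C ρ Γ) (hG : ContDiff ℝ ∞ G) (hG0 : G 0 = 0) (hρ : 0 < ρ) {t : ℝ}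
    (ht : t ∈ Ioo (-C) C) :
    ((fderiv ℝ Γ (-t, 0)).comp (ContinuousLinearMap.inr ℝ ℝ Plane)).comp
      ((fderiv ℝ Γ (t, 0)).comp (ContinuousLinearMap.inr ℝ ℝ Plane)) =
        ContinuousLinearMap.id ℝ Plane := by
  have ht' : -t ∈ Ioo (-C) C := ⟨by linarith [ht.2], by linarith [ht.1]⟩
  have slice : ∀ s ∈ Ioo (-C) C, HasFDerivAt (fun z => Γ (s, z))
      ((fderiv ℝ Γ (s, 0)).comp (ContinuousLinearMap.inr ℝ ℝ Plane)) 0 := fun s hs =>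
    HasFDerivAt.comp (g := Γ) (0 : Plane) (h.hasFDerivAt_slice hρ hs) (hasFDerivAt_prodMk_right s 0)
  have h0 := h.apply_zero hG hG0 hρ ht
  have h1 : HasFDerivAt (fun z => Γ (-t, Γ (t, z))) _ 0 :=
    HasFDerivAt.comp (g := fun z => Γ (-t, z)) (f := fun z => Γ (t, z)) (0 : Plane)
      (by rw [h0]; exact slice _ ht') (slice t ht)
  refine h1.unique ((hasFDerivAt_id (0 : Plane)).congr_of_eventuallyEq ?_)
  have hc : ContinuousAt (fun z => Γ (t, z)) 0 := (slice t ht).continuousAt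
  have hm : Metric.ball (0 : Plane) ρ ∈ 𝓝 (Γ (t, 0)) := by
    rw [h0]; exact Metric.ball_mem_nhds _ hρ
  filter_upwards [hc.preimage_mem_nhds hm, Metric.ball_mem_nhds (0 : Plane) hρ] with z hz hz'
  have h2 := (h.flowsTo t ht z hz').trans hG (h.flowsTo (-t) ht' _ hz)
  rw [add_neg_cancel] at h2
  exact h2.unique hG (FlowsTo.zero hG z)

/-- The isotopy contracts the shift function: `H t z = 𝐆(z, t α(z))`. -/
theorem shiftGerms_subset_identityComponent {G : Plane → Plane} (hG : ContDiff ℝ ∞ G)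
    (hG0 : G 0 = 0) : shiftGerms G ⊆ identityComponent G := by
  rintro _ ⟨f, α₀, rfl, ⟨U, hU, h0U, hα₀⟩, hf⟩
  obtain ⟨α, hα, hαeq⟩ := exists_contDiff_eventuallyEq hU hα₀ h0U
  set C := |α 0| + 1 with hC
  obtain ⟨ρ, hρ, Γ, h⟩ := exists_isSmoothFlow hG hG0 C
  let V : Set Plane := Metric.ball 0 ρ ∩ {z | |α z| < C}
  have hV : IsOpen V := Metric.isOpen_ball.inter (isOpen_lt hα.continuous.abs continuous_const)
  have h0V : (0 : Plane) ∈ V := ⟨Metric.mem_ball_self hρ, by simp [hC]⟩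
  have htime : ∀ t ∈ Icc (0 : ℝ) 1, ∀ z ∈ V, t * α z ∈ Ioo (-C) C := by
    intro t ht z hz
    rw [mem_Ioo, ← abs_lt, abs_mul, abs_of_nonneg ht.1]
    exact (mul_le_of_le_one_left (abs_nonneg _) ht.2).trans_lt hz.2
  let j : ℝ × Plane → ℝ × Plane := fun q => (q.1 * α q.2, q.2)
  have hj : ContDiff ℝ ∞ j := (contDiff_fst.mul (hα.comp contDiff_snd)).prodMk contDiff_snd
  let Ω : Set (ℝ × Plane) := j ⁻¹' (Ioo (-C) C ×ˢ Metric.ball 0 ρ)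
  have hΩ : IsOpen Ω := (isOpen_timeBall C ρ).preimage hj.continuous
  let K : ℝ × Plane → Plane := fun q => Γ (j q)
  have hK : ContDiffOn ℝ ∞ K Ω := h.contDiffOn.comp hj.contDiffOn fun q hq => hq
  have hsub : Icc (0 : ℝ) 1 ×ˢ V ⊆ Ω := fun q hq => ⟨htime _ hq.1 _ hq.2, hq.2.1⟩
  have hflow : ∀ t ∈ Icc (0 : ℝ) 1, ∀ z ∈ V, FlowsTo G z (t * α z) (K (t, z)) :=
    fun t ht z hz => h.flowsTo _ (htime t ht z hz) z hz.1
  have hKt : ∀ t ∈ Icc (0 : ℝ) 1, ContDiffOn ℝ ∞ (fun z => K (t, z)) V := fun t ht =>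
    hK.comp (contDiff_prodMk_right t).contDiffOn fun z hz => hsub ⟨ht, hz⟩
  have hpres : ∀ t ∈ Icc (0 : ℝ) 1, PreservesOrbitsOn G (fun z => K (t, z)) V := by
    rintro t ht z _ ⟨w, ⟨⟨s, hs⟩, hw⟩, rfl⟩
    exact ⟨_, hs.trans hG (hflow t ht w hw)⟩
  refine ⟨V, fun t z => K (t, z), hV, h0V, fun t ht => ⟨⟨fun z => K (t, z), rfl, ?_, V, hV, h0V,
    hpres t ht⟩, hKt t ht, hpres t ht⟩, ?_, ?_, ?_, ?_⟩
  · have hT := htime t ht 0 h0V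
    set T := t * α 0 with hTdef
    have hT' : -T ∈ Ioo (-C) C := ⟨by linarith [hT.2], by linarith [hT.1]⟩
    set L := fderiv ℝ Γ (T, 0) with hL
    -- the equilibrium is fixed for all times, so `Γ` has no time derivative there
    have hL1 : ∀ s : ℝ, L (s, 0) = 0 := by
      have d1 : HasFDerivAt (fun s => Γ (s, 0)) (L.comp (ContinuousLinearMap.inl ℝ ℝ Plane)) T :=
        HasFDerivAt.comp (g := Γ) T (h.hasFDerivAt_slice hρ hT) (hasFDerivAt_prodMk_left T 0)
      have d2 : HasFDerivAt (fun s => Γ (s, 0)) (0 : ℝ →L[ℝ] Plane) T :=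
        (hasFDerivAt_const (0 : Plane) T).congr_of_eventuallyEq <| by
          filter_upwards [isOpen_Ioo.mem_nhds hT] with s hs
          exact h.apply_zero hG hG0 hρ hs
      intro s
      exact congrArg (fun A : ℝ →L[ℝ] Plane => A s) (d1.unique d2)
    have hBA := h.comp_fderiv hG hG0 hρ hT
    have hAB := h.comp_fderiv hG hG0 hρ hT'
    rw [neg_neg] at hAB
    let A : Plane ≃L[ℝ] Plane := ContinuousLinearEquiv.equivOfInverse
      (L.comp (ContinuousLinearMap.inr ℝ ℝ Plane))
      ((fderiv ℝ Γ (-T, 0)).comp (ContinuousLinearMap.inr ℝ ℝ Plane))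
      (fun z => congrArg (fun A : Plane →L[ℝ] Plane => A z) hBA)
      (fun z => congrArg (fun A : Plane →L[ℝ] Plane => A z) hAB)
    have hd : HasFDerivAt (fun z => K (t, z)) (A : Plane →L[ℝ] Plane) 0 := by
      have d1 : HasFDerivAt (fun z => (t * α z, z))
          ((t • fderiv ℝ α 0).prod (ContinuousLinearMap.id ℝ Plane)) 0 :=
        ((hα.differentiable (by simp) 0).hasFDerivAt.const_mul t).prodMk (hasFDerivAt_id 0)
      refine (HasFDerivAt.comp (g := Γ) (f := fun z => (t * α z, z)) (0 : Plane)
        (h.hasFDerivAt_slice hρ hT) d1).congr_fderiv ?_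
      refine ContinuousLinearMap.ext fun z => ?_
      have : ((t • fderiv ℝ α 0) z, z) = ((t • fderiv ℝ α 0) z, (0 : Plane)) + ((0 : ℝ), z) := by
        simp
      change L ((t • fderiv ℝ α 0) z, z) = L (0, z)
      rw [this, map_add, hL1, zero_add]
    obtain ⟨e, he0, -, hec, hes, hes'⟩ :=
      exists_smooth_openPartialHomeomorph hV (hKt t ht) h0V A hd
    refine ⟨e, ⟨he0, ?_, hes, hes'⟩, Eventually.of_forall fun z => (hec z).symm⟩
    rw [hec]
    exact h.apply_zero hG hG0 hρ hT
  · exact hK.continuousOn.mono hsub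
  · have h1 : ContinuousOn (fun q => (fderiv ℝ K q).comp (ContinuousLinearMap.inr ℝ ℝ Plane))
        (Icc (0 : ℝ) 1 ×ˢ V) :=
      ((hK.continuousOn_fderiv_of_isOpen hΩ (by simp)).mono hsub).clm_comp continuousOn_const
    refine h1.congr fun q hq => ?_
    have h2 : HasFDerivAt K (fderiv ℝ K q) (q.1, q.2) :=
      ((hK.contDiffAt (hΩ.mem_nhds (hsub hq))).differentiableAt (by simp)).hasFDerivAt
    exact (HasFDerivAt.comp (g := K) q.2 h2 (hasFDerivAt_prodMk_right q.1 q.2)).fderiv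
  · intro z hz
    have := hflow 0 (by simp) z hz
    rw [zero_mul] at this
    exact this.unique hG (FlowsTo.zero hG z)
  · refine Germ.coe_eq.2 ?_
    filter_upwards [hf, hαeq, hV.mem_nhds h0V] with z h1 h2 h3
    have := hflow 1 (by simp) z h3
    rw [one_mul, h2] at this
    exact h1.unique hG this

/-! ### Binary forms without multiple factors -/

/-- The polynomial function on the plane given by a polynomial in two variables. -/
noncomputable def polyFun (g : MvPolynomial (Fin 2) ℝ) (z : Plane) : ℝ :=
  MvPolynomial.eval ![z.1, z.2] g

theorem hamiltonian_eq (g : MvPolynomial (Fin 2) ℝ) (z : Plane) :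
    hamiltonian g z =
      (-polyFun (MvPolynomial.pderiv 1 g) z, polyFun (MvPolynomial.pderiv 0 g) z) := rfl

theorem contDiff_polyFun (g : MvPolynomial (Fin 2) ℝ) : ContDiff ℝ ∞ (polyFun g) := by
  unfold polyFun
  induction g using MvPolynomial.induction_on with
  | C a => simpa using contDiff_const
  | add p q hp hq => simpa using hp.add hq
  | mul_X p i hp =>
    simp only [map_mul, MvPolynomial.eval_X]
    refine hp.mul ?_
    fin_cases i
    · exact contDiff_fst
    · exact contDiff_snd

theorem contDiff_hamiltonian (g : MvPolynomial (Fin 2) ℝ) : ContDiff ℝ ∞ (hamiltonian g) :=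
  (contDiff_polyFun _).neg.prodMk (contDiff_polyFun _)

theorem hasFDerivAt_polyFun (g : MvPolynomial (Fin 2) ℝ) (z : Plane) :
    HasFDerivAt (polyFun g)
      (polyFun (MvPolynomial.pderiv 0 g) z • ContinuousLinearMap.fst ℝ ℝ ℝ +
        polyFun (MvPolynomial.pderiv 1 g) z • ContinuousLinearMap.snd ℝ ℝ ℝ) z := by
  unfold polyFun
  induction g using MvPolynomial.induction_on with
  | C a => simpa using hasFDerivAt_const a z
  | add p q hp hq =>
    simp only [map_add]
    refine (hp.add hq).congr_fderiv ?_
    ext <;> simp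
  | mul_X p i hp =>
    simp only [map_mul, MvPolynomial.eval_X, MvPolynomial.pderiv_mul, map_add]
    fin_cases i
    · refine (hp.mul (hasFDerivAt_fst (𝕜 := ℝ) (p := z))).congr_fderiv ?_
      ext <;> simp [MvPolynomial.pderiv_X] <;> ring
    · refine (hp.mul (hasFDerivAt_snd (𝕜 := ℝ) (p := z))).congr_fderiv ?_
      ext <;> simp [MvPolynomial.pderiv_X] <;> ring

theorem polyFun_smul {g : MvPolynomial (Fin 2) ℝ} {n : ℕ} (hg : g.IsHomogeneous n) (t : ℝ)
    (z : Plane) : polyFun g (t • z) = t ^ n * polyFun g z := by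
  have h : (![(t • z).1, (t • z).2] : Fin 2 → ℝ) = fun i => t * ![z.1, z.2] i := by
    ext i; fin_cases i <;> simp
  unfold polyFun
  rw [h, MvPolynomial.eval_eq', MvPolynomial.eval_eq', Finset.mul_sum]
  refine Finset.sum_congr rfl fun d hd => ?_
  have hdeg : d 0 + d 1 = n := by
    have := hg (MvPolynomial.mem_support_iff.1 hd)
    simpa [Finsupp.weight_apply, Finsupp.sum_fintype, Fin.sum_univ_two] using this
  simp only [Fin.prod_univ_two, mul_pow, ← hdeg, pow_add]
  ring

theorem hamiltonian_smul {g : MvPolynomial (Fin 2) ℝ} {n : ℕ} (hg : g.IsHomogeneous n) (t : ℝ)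
    (z : Plane) : hamiltonian g (t • z) = t ^ (n - 1) • hamiltonian g z := by
  rw [hamiltonian_eq, hamiltonian_eq, polyFun_smul hg.pderiv, polyFun_smul hg.pderiv]
  ext <;> simp

/-- Euler's identity. -/
theorem euler_polyFun {g : MvPolynomial (Fin 2) ℝ} {n : ℕ} (hg : g.IsHomogeneous n) (z : Plane) :
    z.1 * polyFun (MvPolynomial.pderiv 0 g) z + z.2 * polyFun (MvPolynomial.pderiv 1 g) z =
      n * polyFun g z := by
  have := congrArg (fun p => polyFun p z) hg.sum_X_mul_pderiv
  simpa [polyFun, Fin.sum_univ_two] using this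

/-- The dehomogenization `g(X, 1)` of a binary form `g`. -/
noncomputable def dehomogenize (g : MvPolynomial (Fin 2) ℝ) : Polynomial ℝ :=
  MvPolynomial.aeval ![Polynomial.X, 1] g

theorem homogenize_dehomogenize {g : MvPolynomial (Fin 2) ℝ} {n : ℕ} (hg : g.IsHomogeneous n) :
    (dehomogenize g).homogenize n = g :=
  Polynomial.homogenize_eq_of_isHomogeneous hg rfl

theorem natDegree_dehomogenize_le {g : MvPolynomial (Fin 2) ℝ} {n : ℕ}
    (hg : g.IsHomogeneous n) : (dehomogenize g).natDegree ≤ n := by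
  unfold dehomogenize
  rw [g.as_sum, map_sum]
  refine Polynomial.natDegree_sum_le_of_forall_le _ _ fun d hd => ?_
  have hdeg : d 0 + d 1 = n := by
    have := hg (MvPolynomial.mem_support_iff.1 hd)
    simpa [Finsupp.weight_apply, Finsupp.sum_fintype, Fin.sum_univ_two] using this
  rw [MvPolynomial.aeval_monomial, Finsupp.prod_fintype _ _ (by simp)]
  simp only [Fin.prod_univ_two, Matrix.cons_val_zero, Matrix.cons_val_one, one_pow, mul_one]
  refine (Polynomial.natDegree_C_mul_X_pow_le _ _).trans (by omega)

theorem derivative_dehomogenize (g : MvPolynomial (Fin 2) ℝ) :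
    Polynomial.derivative (dehomogenize g) = dehomogenize (MvPolynomial.pderiv 0 g) := by
  unfold dehomogenize
  induction g using MvPolynomial.induction_on with
  | C a => simp
  | add p q hp hq => simp [hp, hq]
  | mul_X p i hp =>
    fin_cases i <;>
      simp [hp, MvPolynomial.pderiv_X, Polynomial.derivative_mul, mul_comm]

theorem squarefree_dehomogenize {g : MvPolynomial (Fin 2) ℝ} {n : ℕ} (hg : g.IsHomogeneous n)
    (hsq : Squarefree g) : Squarefree (dehomogenize g) := by
  rintro r ⟨s, hs⟩
  have hg0 : g ≠ 0 := hsq.ne_zero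
  have hf0 : dehomogenize g ≠ 0 := by
    intro h
    apply hg0
    rw [← homogenize_dehomogenize hg, h, Polynomial.homogenize_zero]
  have hr0 : r ≠ 0 := by rintro rfl; simp [hf0] at hs
  have hs0 : s ≠ 0 := by rintro rfl; simp [hf0] at hs
  have hdeg := natDegree_dehomogenize_le hg
  rw [hs, Polynomial.natDegree_mul (mul_ne_zero hr0 hr0) hs0,
    Polynomial.natDegree_mul hr0 hr0] at hdeg
  have hn : n = (r.natDegree + r.natDegree) + (n - (r.natDegree + r.natDegree)) := by omega
  have h1 : g = r.homogenize r.natDegree * r.homogenize r.natDegree *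
      s.homogenize (n - (r.natDegree + r.natDegree)) := by
    rw [← Polynomial.homogenize_mul r r le_rfl le_rfl, ← Polynomial.homogenize_mul _ s
      (Polynomial.natDegree_mul hr0 hr0).le (by omega), ← hn, ← hs, homogenize_dehomogenize hg]
  have h2 := (hsq _ ⟨_, h1⟩).map (MvPolynomial.aeval ![(Polynomial.X : Polynomial ℝ), 1])
  rwa [Polynomial.aeval_homogenize_X_one r le_rfl] at h2

theorem euler_dehomogenize {g : MvPolynomial (Fin 2) ℝ} {n : ℕ} (hg : g.IsHomogeneous n) :
    Polynomial.X * dehomogenize (MvPolynomial.pderiv 0 g) +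
      dehomogenize (MvPolynomial.pderiv 1 g) = (n : Polynomial ℝ) * dehomogenize g := by
  have := congrArg dehomogenize hg.sum_X_mul_pderiv
  simpa [dehomogenize, Fin.sum_univ_two] using this

/-- The partial derivatives of a binary form without multiple factors generate an ideal that
contains a power of the second variable. -/
theorem exists_bezout_pderiv {g : MvPolynomial (Fin 2) ℝ} {n : ℕ} (hn : n ≠ 0)
    (hg : g.IsHomogeneous n) (hsq : Squarefree g) :
    ∃ (A B : MvPolynomial (Fin 2) ℝ) (m : ℕ),
      A * MvPolynomial.pderiv 0 g + B * MvPolynomial.pderiv 1 g = MvPolynomial.X 1 ^ m := by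
  obtain ⟨a, b, hab⟩ := (Polynomial.separable_def _).1
    (PerfectField.separable_iff_squarefree.2 (squarefree_dehomogenize hg hsq))
  rw [derivative_dehomogenize] at hab
  set p := dehomogenize (MvPolynomial.pderiv 0 g) with hp
  set q := dehomogenize (MvPolynomial.pderiv 1 g) with hq
  have hnC : Polynomial.C ((n : ℝ)⁻¹) * (n : Polynomial ℝ) = 1 := by
    rw [← Polynomial.C_eq_natCast, ← Polynomial.C_mul, inv_mul_cancel₀ (by exact_mod_cast hn),
      Polynomial.C_1]
  let u : Polynomial ℝ := Polynomial.C ((n : ℝ)⁻¹) * a * Polynomial.X + b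
  let v : Polynomial ℝ := Polynomial.C ((n : ℝ)⁻¹) * a
  have huv : u * p + v * q = 1 := by
    have := euler_dehomogenize hg
    calc u * p + v * q = Polynomial.C ((n : ℝ)⁻¹) * a * (Polynomial.X * p + q) + b * p := by
          simp only [u, v]; ring
      _ = (Polynomial.C ((n : ℝ)⁻¹) * n) * (a * dehomogenize g) + b * p := by rw [this]; ring
      _ = 1 := by rw [hnC, one_mul, hab]
  let M := max u.natDegree v.natDegree
  refine ⟨u.homogenize M, v.homogenize M, M + (n - 1), ?_⟩
  have h0 := Polynomial.homogenize_mul u p (le_max_left u.natDegree v.natDegree)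
    (natDegree_dehomogenize_le hg.pderiv)
  have h1 := Polynomial.homogenize_mul v q (le_max_right u.natDegree v.natDegree)
    (natDegree_dehomogenize_le hg.pderiv)
  rw [homogenize_dehomogenize hg.pderiv] at h0 h1
  rw [← h0, ← h1, ← Polynomial.homogenize_add, huv, Polynomial.homogenize_one]

theorem polyFun_homogenize_axis (p : Polynomial ℝ) (n : ℕ) (x : ℝ) :
    polyFun (p.homogenize n) (x, 0) = p.coeff n * x ^ n := by
  unfold polyFun Polynomial.homogenize
  rw [map_sum, Finset.sum_eq_single (n, 0)]
  · simp [MvPolynomial.eval_monomial, Finsupp.prod_fintype]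
  · rintro ⟨k, l⟩ hkl hne
    have hl : l ≠ 0 := by
      rintro rfl
      have : k + 0 = n := Finset.HasAntidiagonal.mem_antidiagonal.1 hkl
      exact hne (by rw [← this, add_zero])
    simp [MvPolynomial.eval_monomial, Finsupp.prod_fintype, hl]
  · simp

/-- A binary form without multiple factors has no critical points on the axis `y = 0` other than
the origin: otherwise `y ^ 2` would divide it. -/
theorem pderiv_ne_zero_on_axis {g : MvPolynomial (Fin 2) ℝ} {n : ℕ} (hn : 2 ≤ n)
    (hg : g.IsHomogeneous n) (hsq : Squarefree g) {x : ℝ} (hx : x ≠ 0)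
    (h0 : polyFun (MvPolynomial.pderiv 0 g) (x, 0) = 0)
    (h1 : polyFun (MvPolynomial.pderiv 1 g) (x, 0) = 0) : False := by
  set f := dehomogenize g with hf
  rw [← homogenize_dehomogenize (hg.pderiv (i := 0)), polyFun_homogenize_axis] at h0
  rw [← homogenize_dehomogenize (hg.pderiv (i := 1)), polyFun_homogenize_axis] at h1
  have hx' : x ^ (n - 1) ≠ 0 := pow_ne_zero _ hx
  have h0' := (mul_eq_zero.1 h0).resolve_right hx'
  have h1' := (mul_eq_zero.1 h1).resolve_right hx'
  obtain ⟨k, rfl⟩ : ∃ k, n = k + 2 := ⟨n - 2, by omega⟩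
  have hE := euler_dehomogenize hg
  have c2 : f.coeff (k + 2) = 0 := by
    rw [← derivative_dehomogenize, Polynomial.coeff_derivative] at h0'
    refine (mul_eq_zero.1 h0').resolve_right ?_
    positivity
  have c1 : f.coeff (k + 1) = 0 := by
    have := congrArg (fun p : Polynomial ℝ => Polynomial.coeff p (k + 1)) hE
    simp only [Polynomial.coeff_add, Polynomial.coeff_X_mul, ← derivative_dehomogenize,
      Polynomial.coeff_derivative, Polynomial.coeff_natCast_mul] at this
    rw [← hf] at this
    simp only [show k + 2 - 1 = k + 1 by omega] at h1'
    rw [h1'] at this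
    push_cast at this
    linarith
  have hdeg : f.natDegree ≤ k := by
    have h2 := natDegree_dehomogenize_le hg
    rw [← hf] at h2
    rw [Polynomial.natDegree_le_iff_coeff_eq_zero]
    intro N hN
    rcases lt_or_ge (k + 2) N with h | h
    · exact Polynomial.coeff_eq_zero_of_natDegree_lt (h2.trans_lt h)
    · obtain rfl | rfl : N = k + 1 ∨ N = k + 2 := by omega
      · exact c1
      · exact c2
  have hfac : g = MvPolynomial.X 1 * MvPolynomial.X 1 * f.homogenize k := by
    have := Polynomial.homogenize_mul f 1 hdeg (n := 2) (by simp)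
    rw [mul_one, Polynomial.homogenize_one, homogenize_dehomogenize hg] at this
    rw [this]; ring
  have hu := (hsq _ ⟨_, hfac⟩).map (MvPolynomial.eval (0 : Fin 2 → ℝ))
  simp at hu

/-! ### Division by a Hamiltonian field -/

/-- Hadamard's lemma on the axis `y = 0`. -/
theorem exists_eq_snd_mul {c : Plane → ℝ} (hc : ContDiff ℝ ∞ c) (h0 : ∀ x, c (x, 0) = 0) :
    ∃ b : Plane → ℝ, ContDiff ℝ ∞ b ∧ ∀ z, c z = z.2 * b z := by
  let F : ℝ × Plane → ℝ := fun q => fderiv ℝ c (q.2.1, q.1 * q.2.2) (0, 1)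
  have hF : ContDiff ℝ ∞ F := by
    have h1 : ContDiff ℝ ∞ (fderiv ℝ c) := hc.fderiv_right (m := ∞) (by simp)
    have h2 : ContDiff ℝ ∞ (fun q : ℝ × Plane => (q.2.1, q.1 * q.2.2)) := by fun_prop
    exact (h1.comp h2).clm_apply contDiff_const
  refine ⟨_, contDiff_integral_zero_one hF, fun z => ?_⟩
  have h1 : ∀ s ∈ uIcc (0 : ℝ) 1, HasDerivAt (fun s => c (z.1, s * z.2)) (z.2 * F (s, z)) s := by
    intro s _
    have d1 : HasDerivAt (fun s : ℝ => (z.1, s * z.2)) (0, z.2) s := by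
      simpa using (hasDerivAt_const s z.1).prodMk ((hasDerivAt_id s).mul_const z.2)
    have d2 := ((hc.differentiable (by simp)) (z.1, s * z.2)).hasFDerivAt.comp_hasDerivAt s d1
    have : (0, z.2) = z.2 • ((0 : ℝ), (1 : ℝ)) := by simp
    rw [this, map_smul] at d2
    exact d2
  have h2 : Continuous fun s => z.2 * F (s, z) :=
    continuous_const.mul (hF.continuous.comp (by fun_prop))
  have h3 := intervalIntegral.integral_eq_sub_of_hasDerivAt h1 (h2.intervalIntegrable 0 1)
  rw [intervalIntegral.integral_const_mul] at h3
  simpa [h0] using h3.symm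

theorem eq_of_eq_off_axis {u v : Plane → ℝ} (hu : Continuous u) (hv : Continuous v)
    (h : ∀ z : Plane, z.2 ≠ 0 → u z = v z) : u = v := by
  have hd : Dense {z : Plane | z.2 ≠ 0} :=
    (dense_compl_singleton (0 : ℝ)).preimage isOpenMap_snd
  exact Continuous.ext_on hd hu hv h

/-- A smooth field `Y` annihilated by `dg`, for a binary form `g` without multiple factors, is a
smooth multiple of the Hamiltonian field of `g`.  With `A g_x + B g_y = y ^ m` the function
`c = A Y₂ - B Y₁` satisfies `y ^ m Y = c H`; since `H` has no zero on the axis other than the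
origin, `c` can be divided by `y` as many as `m` times. -/
theorem exists_eq_smul_hamiltonian {g : MvPolynomial (Fin 2) ℝ} {n : ℕ} (hn : 2 ≤ n)
    (hg : g.IsHomogeneous n) (hsq : Squarefree g) {Y : Plane → Plane} (hY : ContDiff ℝ ∞ Y)
    (hYg : ∀ z, polyFun (MvPolynomial.pderiv 0 g) z * (Y z).1 +
      polyFun (MvPolynomial.pderiv 1 g) z * (Y z).2 = 0) :
    ∃ b : Plane → ℝ, ContDiff ℝ ∞ b ∧ ∀ z, Y z = b z • hamiltonian g z := by
  set p := polyFun (MvPolynomial.pderiv 0 g) with hp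
  set q := polyFun (MvPolynomial.pderiv 1 g) with hq
  have hpc : Continuous p := (contDiff_polyFun _).continuous
  have hqc : Continuous q := (contDiff_polyFun _).continuous
  have key : ∀ (m : ℕ) (c : Plane → ℝ), ContDiff ℝ ∞ c →
      (∀ z, z.2 ^ m * (Y z).2 = p z * c z) → (∀ z, z.2 ^ m * (Y z).1 = -(q z * c z)) →
      ∃ b : Plane → ℝ, ContDiff ℝ ∞ b ∧ ∀ z, Y z = b z • hamiltonian g z := by
    intro m
    induction m with
    | zero =>
      intro c hc h2 h1
      refine ⟨c, hc, fun z => ?_⟩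
      have e1 := h1 z
      have e2 := h2 z
      rw [hamiltonian_eq]
      ext
      · simpa [mul_comm] using e1
      · simpa [mul_comm] using e2
    | succ m ih =>
      intro c hc h2 h1
      have hc0 : ∀ x, c (x, 0) = 0 := by
        have hx : ∀ x : ℝ, x ≠ 0 → c (x, 0) = 0 := by
          intro x hx
          by_contra hne
          have e1 := h1 (x, 0)
          have e2 := h2 (x, 0)
          simp [hne] at e1 e2
          exact pderiv_ne_zero_on_axis hn hg hsq hx e2 e1
        have := Continuous.ext_on (dense_compl_singleton (0 : ℝ))
          (hc.continuous.comp (by fun_prop : Continuous fun x : ℝ => (x, (0 : ℝ))))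
          (continuous_const (y := (0 : ℝ))) hx
        exact fun x => congrFun this x
      obtain ⟨b, hb, hcb⟩ := exists_eq_snd_mul hc hc0
      have hbc := hb.continuous
      have hYc := hY.continuous
      refine ih b hb (fun z => ?_) (fun z => ?_)
      · refine congrFun (eq_of_eq_off_axis (u := fun z => z.2 ^ m * (Y z).2)
          (v := fun z => p z * b z) (by fun_prop) (by fun_prop) fun z hz => ?_) z
        have e := h2 z
        rw [hcb z] at e
        exact mul_left_cancel₀ hz (by linear_combination e)
      · refine congrFun (eq_of_eq_off_axis (u := fun z => z.2 ^ m * (Y z).1)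
          (v := fun z => -(q z * b z)) (by fun_prop) (by fun_prop) fun z hz => ?_) z
        have e := h1 z
        rw [hcb z] at e
        exact mul_left_cancel₀ hz (by linear_combination e)
  obtain ⟨A, B, m, hAB⟩ := exists_bezout_pderiv (by omega) hg hsq
  have hABz : ∀ z, polyFun A z * p z + polyFun B z * q z = z.2 ^ m := by
    intro z
    have := congrArg (fun r => polyFun r z) hAB
    simpa [hp, hq, polyFun] using this
  refine key m (fun z => polyFun A z * (Y z).2 - polyFun B z * (Y z).1) ?_ ?_ ?_
  · exact ((contDiff_polyFun A).mul hY.snd).sub ((contDiff_polyFun B).mul hY.fst)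
  · intro z
    rw [← hABz]
    linear_combination polyFun B z * hYg z
  · intro z
    rw [← hABz]
    linear_combination polyFun A z * hYg z

theorem exists_eventually_eq_smul_hamiltonian {g : MvPolynomial (Fin 2) ℝ} {n : ℕ} (hn : 2 ≤ n)
    (hg : g.IsHomogeneous n) (hsq : Squarefree g) {Y : Plane → Plane} {U : Set Plane}
    (hU : IsOpen U) (h0U : (0 : Plane) ∈ U) (hY : ContDiffOn ℝ ∞ Y U)
    (hYg : ∀ z ∈ U, polyFun (MvPolynomial.pderiv 0 g) z * (Y z).1 +
      polyFun (MvPolynomial.pderiv 1 g) z * (Y z).2 = 0) :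
    ∃ b : Plane → ℝ, ContDiff ℝ ∞ b ∧ ∀ᶠ z in 𝓝 (0 : Plane), Y z = b z • hamiltonian g z := by
  obtain ⟨φ, hφU, hφ, hφ1⟩ := exists_cutoff hU hY h0U
  obtain ⟨b, hb, hbe⟩ := exists_eq_smul_hamiltonian hn hg hsq hφ fun z => by
    by_cases hz : z ∈ U
    · simp only [Prod.smul_fst, Prod.smul_snd, smul_eq_mul]
      linear_combination φ z * hYg z hz
    · simp [hφU z hz]
  exact ⟨b, hb, hφ1.mono fun z hz => by simpa [hz] using hbe z⟩

/-! ### Joining a tangent-to-identity symmetry of a form to the identity -/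

/-- The function `(t, z) ↦ (k (t z) - k 0) / t`, in the form that makes sense for `t = 0` too. -/
noncomputable def radialQuotient {F : Type} [NormedAddCommGroup F] [NormedSpace ℝ F]
    (k : Plane → F) (q : ℝ × Plane) : F :=
  ∫ s in (0 : ℝ)..1, fderiv ℝ k ((s * q.1) • q.2) q.2

theorem contDiff_radialQuotient {F : Type} [NormedAddCommGroup F] [NormedSpace ℝ F]
    [CompleteSpace F] {k : Plane → F} (hk : ContDiff ℝ ∞ k) :
    ContDiff ℝ ∞ (radialQuotient k) := by
  have h1 : ContDiff ℝ ∞ (fderiv ℝ k) := hk.fderiv_right (m := ∞) (by simp)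
  have h2 : ContDiff ℝ ∞ (fun y : ℝ × (ℝ × Plane) => (y.1 * y.2.1) • y.2.2) := by fun_prop
  have h3 : ContDiff ℝ ∞ (fun y : ℝ × (ℝ × Plane) => y.2.2) := by fun_prop
  exact contDiff_integral_zero_one (f := fun y : ℝ × (ℝ × Plane) =>
    fderiv ℝ k ((y.1 * y.2.1) • y.2.2) y.2.2) ((h1.comp h2).clm_apply h3)

theorem smul_radialQuotient {F : Type} [NormedAddCommGroup F] [NormedSpace ℝ F]
    [CompleteSpace F] {k : Plane → F} (hk : ContDiff ℝ ∞ k) (t : ℝ) (z : Plane) :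
    t • radialQuotient k (t, z) = k (t • z) - k 0 := by
  have h1 : ∀ s ∈ uIcc (0 : ℝ) 1,
      HasDerivAt (fun s : ℝ => k ((s * t) • z)) (t • fderiv ℝ k ((s * t) • z) z) s := by
    intro s _
    have d1 : HasDerivAt (fun s : ℝ => (s * t) • z) (t • z) s := by
      simpa using ((hasDerivAt_id s).mul_const t).smul_const z
    have d2 := ((hk.differentiable (by simp)) ((s * t) • z)).hasFDerivAt.comp_hasDerivAt s d1
    rwa [map_smul] at d2
  have h2 : Continuous fun s : ℝ => t • fderiv ℝ k ((s * t) • z) z := by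
    have := hk.continuous_fderiv (by simp)
    fun_prop
  have h3 := intervalIntegral.integral_eq_sub_of_hasDerivAt h1 (h2.intervalIntegrable 0 1)
  rw [intervalIntegral.integral_smul] at h3
  simpa [radialQuotient] using h3

theorem radialQuotient_zero_left {F : Type} [NormedAddCommGroup F] [NormedSpace ℝ F]
    [CompleteSpace F] (k : Plane → F) (z : Plane) :
    radialQuotient k (0, z) = fderiv ℝ k 0 z := by
  simp [radialQuotient]

theorem radialQuotient_zero_right {F : Type} [NormedAddCommGroup F] [NormedSpace ℝ F]
    (k : Plane → F) (t : ℝ) : radialQuotient k (t, 0) = 0 := by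
  simp [radialQuotient]

/-- For a symmetry `k` of the form `g`, the defect of homogeneity `Dk(z) z - k(z)` is tangent to
the level curve of `g` through `k z`, hence a smooth multiple of the Hamiltonian field there. -/
theorem exists_homogeneity_defect {g : MvPolynomial (Fin 2) ℝ} {n : ℕ} (hn : 2 ≤ n)
    (hg : g.IsHomogeneous n) (hsq : Squarefree g) {k : Plane → Plane} (hk : ContDiff ℝ ∞ k)
    (hk0 : k 0 = 0) (hk' : HasFDerivAt k (ContinuousLinearMap.id ℝ Plane) 0)
    (hgk : ∀ᶠ z in 𝓝 (0 : Plane), polyFun g (k z) = polyFun g z) :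
    ∃ b : Plane → ℝ, ContDiff ℝ ∞ b ∧
      ∀ᶠ z in 𝓝 (0 : Plane), fderiv ℝ k z z - k z = b z • hamiltonian g (k z) := by
  obtain ⟨e, he0, -, hec, -, hes⟩ := exists_smooth_openPartialHomeomorph isOpen_univ
    hk.contDiffOn (mem_univ 0) (ContinuousLinearEquiv.refl ℝ Plane) hk'
  have he00 : e 0 = 0 := by rw [hec, hk0]
  have h0t : (0 : Plane) ∈ e.target := by simpa [he00] using e.map_source he0
  have hs0 : e.symm 0 = 0 := by simpa [he00] using e.left_inv he0
  let Z : Plane → Plane := fun z => fderiv ℝ k z z - k z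
  have hZ : ContDiff ℝ ∞ Z :=
    ((hk.fderiv_right (m := ∞) (by simp)).clm_apply contDiff_id).sub hk
  obtain ⟨W, hW, hWo, h0W⟩ := eventually_nhds_iff.1 (hgk.eventually_nhds)
  let U := e.target ∩ e.symm ⁻¹' W
  have hU : IsOpen U := e.symm.isOpen_inter_preimage hWo
  have h0U : (0 : Plane) ∈ U := ⟨h0t, by simpa [hs0] using h0W⟩
  obtain ⟨b, hb, hbe⟩ := exists_eventually_eq_smul_hamiltonian hn hg hsq hU h0U
    (Y := fun w => Z (e.symm w)) (hZ.comp_contDiffOn (hes.mono inter_subset_left)) (by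
      rintro w ⟨hwt, hwW⟩
      set z := e.symm w with hz
      have hkz : k z = w := by rw [← hec]; exact e.right_inv hwt
      have hev : (fun z => polyFun g (k z)) =ᶠ[𝓝 z] polyFun g := hW z hwW
      have d1 := (hasFDerivAt_polyFun g (k z)).comp z ((hk.differentiable (by simp)) z).hasFDerivAt
      have d2 := congrArg (fun A : Plane →L[ℝ] ℝ => A z)
        (d1.unique ((hasFDerivAt_polyFun g z).congr_of_eventuallyEq hev))
      have e1 := euler_polyFun hg (k z)
      have e2 := euler_polyFun hg z
      have e3 : polyFun g (k z) = polyFun g z := hev.self_of_nhds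
      simp only [ContinuousLinearMap.comp_apply, add_apply,
        smul_apply, ContinuousLinearMap.coe_fst', ContinuousLinearMap.coe_snd',
        smul_eq_mul] at d2
      simp only [Z, Prod.fst_sub, Prod.snd_sub]
      rw [hkz] at d2 e1 e3 ⊢
      linear_combination d2 - e1 + e2 + n * (-e3))
  refine ⟨fun z => b (k z), hb.comp hk, ?_⟩
  have hkc : Tendsto k (𝓝 0) (𝓝 0) := by simpa [hk0] using hk.continuous.tendsto 0
  filter_upwards [hkc.eventually hbe, e.open_source.mem_nhds he0] with z hz hzs
  have hl : e.symm (k z) = z := by rw [← hec]; exact e.left_inv hzs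
  simpa only [hl, Z] using hz

/-- Alexander's trick: the symmetries `k (t z) / t` of the homogeneous form `g` join a symmetry
tangent to the identity to the identity itself, and the velocity of this isotopy is a smooth
multiple of the Hamiltonian field. -/
theorem exists_hamiltonian_path_of_tangent_to_id {g : MvPolynomial (Fin 2) ℝ} {n : ℕ} (hn : 2 ≤ n)
    (hg : g.IsHomogeneous n) (hsq : Squarefree g) {k : Plane → Plane} (hk : ContDiff ℝ ∞ k)
    (hk0 : k 0 = 0) (hk' : HasFDerivAt k (ContinuousLinearMap.id ℝ Plane) 0)
    (hgk : ∀ᶠ z in 𝓝 (0 : Plane), polyFun g (k z) = polyFun g z) :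
    ∃ (K : ℝ × Plane → Plane) (β : ℝ × Plane → ℝ), ContDiff ℝ ∞ K ∧ ContDiff ℝ ∞ β ∧
      (∀ t, K (t, 0) = 0) ∧ (∀ z, K (0, z) = z) ∧ (∀ z, K (1, z) = k z) ∧
      ∀ᶠ z in 𝓝 (0 : Plane), ∀ t ∈ Icc (0 : ℝ) 1,
        HasDerivAt (fun t => K (t, z)) (β (t, z) • hamiltonian g (K (t, z))) t := by
  obtain ⟨b, hb, hbe⟩ := exists_homogeneity_defect hn hg hsq hk hk0 hk' hgk
  set K := radialQuotient k with hKdef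
  have hK : ContDiff ℝ ∞ K := contDiff_radialQuotient hk
  have hKs : ∀ (t : ℝ) (z : Plane), t • K (t, z) = k (t • z) := fun t z => by
    rw [hKdef, smul_radialQuotient hk, hk0, sub_zero]
  have hK0 : ∀ z, K (0, z) = z := fun z => by
    rw [hKdef, radialQuotient_zero_left, hk'.fderiv]; rfl
  obtain ⟨r, hr, hrb⟩ := Metric.eventually_nhds_iff_ball.1 hbe
  have hball : ∀ z ∈ Metric.ball (0 : Plane) r, ∀ t ∈ Icc (0 : ℝ) 1,
      t • z ∈ Metric.ball (0 : Plane) r := by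
    intro z hz t ht
    rw [mem_ball_zero_iff] at hz ⊢
    rw [norm_smul, Real.norm_of_nonneg ht.1]
    exact (mul_le_of_le_one_left (norm_nonneg _) ht.2).trans_lt hz
  have hHs : ∀ (t : ℝ) (z : Plane),
      hamiltonian g (k (t • z)) = t ^ (n - 1) • hamiltonian g (K (t, z)) := fun t z => by
    rw [← hKs, hamiltonian_smul hg]
  have hHc : Continuous (hamiltonian g) := (contDiff_hamiltonian g).continuous
  -- the multiplier divided by the power of `t` that homogeneity produces
  have hβ : ∃ β : ℝ × Plane → ℝ, ContDiff ℝ ∞ β ∧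
      ∀ t z, t ^ (n - 1) * b (t • z) = t ^ 2 * β (t, z) := by
    rcases eq_or_lt_of_le hn with rfl | hn3
    · have hb0 : b 0 = 0 := by
        let z : Plane := (r / 2, 0)
        have hz : z ∈ Metric.ball (0 : Plane) r := by
          simp only [z, mem_ball_zero_iff, Prod.norm_def, norm_zero]
          rw [Real.norm_of_nonneg (by positivity), max_eq_left (by positivity)]
          linarith
        have hc1 : Continuous fun t : ℝ => fderiv ℝ k (t • z) z - K (t, z) := by
          have h1 := hk.continuous_fderiv (by simp)
          have h2 := hK.continuous
          fun_prop
        have hc2 : Continuous fun t : ℝ => b (t • z) • hamiltonian g (K (t, z)) := by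
          have h1 := hb.continuous
          have h2 := hK.continuous
          fun_prop
        have heq : EqOn (fun t : ℝ => fderiv ℝ k (t • z) z - K (t, z))
            (fun t => b (t • z) • hamiltonian g (K (t, z))) (Ioo 0 1) := by
          intro t ht
          have h1 := hrb _ (hball z hz t ⟨ht.1.le, ht.2.le⟩)
          rw [hHs, ← hKs, map_smul, ← smul_sub, smul_comm] at h1
          simpa [ht.1.ne'] using h1
        have h0 := heq.closure hc1 hc2 (x := 0) (by
          rw [closure_Ioo (by norm_num)]; simp)
        simp only [zero_smul, hK0, hk'.fderiv, ContinuousLinearMap.id_apply, sub_self] at h0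
        rcases smul_eq_zero.1 h0.symm with h | h
        · exact h
        · rw [hamiltonian_eq, Prod.mk_eq_zero, neg_eq_zero] at h
          exact (pderiv_ne_zero_on_axis le_rfl hg hsq (half_pos hr).ne' h.2 h.1).elim
      refine ⟨radialQuotient b, contDiff_radialQuotient hb, fun t z => ?_⟩
      have := smul_radialQuotient hb t z
      rw [hb0, sub_zero, smul_eq_mul] at this
      rw [← this]
      ring
    · refine ⟨fun q => q.1 ^ (n - 3) * b (q.1 • q.2), ?_, fun t z => ?_⟩
      · exact (contDiff_fst.pow _).mul (hb.comp (contDiff_fst.smul contDiff_snd))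
      · rw [← mul_assoc, ← pow_add]
        congr 2
        omega
  obtain ⟨β, hβc, hβ⟩ := hβ
  refine ⟨K, β, hK, hβc, radialQuotient_zero_right k, hK0, fun z => by simpa using hKs 1 z, ?_⟩
  filter_upwards [Metric.ball_mem_nhds (0 : Plane) hr] with z hz
  have hd : ∀ t, HasDerivAt (fun t => K (t, z)) (fderiv ℝ K (t, z) (1, 0)) t := by
    intro t
    have d1 : HasDerivAt (fun t : ℝ => (t, z)) ((1 : ℝ), (0 : Plane)) t :=
      (hasDerivAt_id t).prodMk (hasDerivAt_const t z)
    exact ((hK.differentiable (by simp)) (t, z)).hasFDerivAt.comp_hasDerivAt t d1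
  have heq : EqOn (fun t : ℝ => fderiv ℝ K (t, z) (1, 0))
      (fun t => β (t, z) • hamiltonian g (K (t, z))) (Ioo 0 1) := by
    intro t ht
    -- differentiate `t K(t, z) = k (t z)` in `t`
    have d1 := (hasDerivAt_id t).smul (hd t)
    have d2 : HasDerivAt (fun t : ℝ => k (t • z)) (fderiv ℝ k (t • z) z) t := by
      have d3 : HasDerivAt (fun t : ℝ => t • z) z t := by
        simpa using (hasDerivAt_id t).smul_const z
      exact ((hk.differentiable (by simp)) (t • z)).hasFDerivAt.comp_hasDerivAt t d3
    have d4 : HasDerivAt (fun t : ℝ => k (t • z))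
        (t • fderiv ℝ K (t, z) (1, 0) + (1 : ℝ) • K (t, z)) t := by
      refine HasDerivAt.congr_of_eventuallyEq d1 (Eventually.of_forall fun s => ?_)
      exact (hKs s z).symm
    have d5 := d2.unique d4
    have h1 := hrb _ (hball z hz t ⟨ht.1.le, ht.2.le⟩)
    rw [hHs, map_smul, d5, ← hKs, smul_add, one_smul, add_sub_cancel_right, smul_smul, smul_smul,
      mul_comm (b _), hβ, ← sq, mul_smul] at h1
    exact smul_right_injective Plane (pow_ne_zero 2 ht.1.ne') h1
  have hcl := heq.closure
    (by have := hK.continuous_fderiv (by simp); fun_prop)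
    (by have := hK.continuous; have := hβc.continuous; fun_prop)
  rw [closure_Ioo (by norm_num)] at hcl
  intro t ht
  exact (hd t).congr_deriv (hcl ht)

/-! ### Linear symmetries of a form -/

/-- The linear part of a symmetry of a homogeneous form is a symmetry. -/
theorem polyFun_linear_part {g : MvPolynomial (Fin 2) ℝ} {n : ℕ} (hg : g.IsHomogeneous n)
    {k : Plane → Plane} {L : Plane →L[ℝ] Plane} (hk0 : k 0 = 0) (hk : HasFDerivAt k L 0)
    (hgk : ∀ᶠ z in 𝓝 (0 : Plane), polyFun g (k z) = polyFun g z) (z : Plane) :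
    polyFun g (L z) = polyFun g z := by
  have h1 : Tendsto (fun c : ℝ => c • (k (0 + c⁻¹ • z) - k 0)) atTop (𝓝 (L z)) :=
    HasFDerivAt.lim (𝕜 := ℝ) hk z (c := fun c : ℝ => c) tendsto_norm_atTop_atTop
  have h2 := ((contDiff_polyFun g).continuous.tendsto (L z)).comp h1
  refine tendsto_nhds_unique h2 (Tendsto.congr' ?_ tendsto_const_nhds)
  have h3 : Tendsto (fun c : ℝ => c⁻¹ • z) atTop (𝓝 0) := by
    simpa using (tendsto_inv_atTop_zero (𝕜 := ℝ)).smul_const z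
  filter_upwards [h3.eventually hgk, eventually_gt_atTop 0] with c hc hc0
  simp only [Function.comp, zero_add, hk0, sub_zero]
  rw [polyFun_smul hg, hc, polyFun_smul hg, ← mul_assoc, ← mul_pow, mul_inv_cancel₀ hc0.ne',
    one_pow, one_mul]

/-- The Lie algebra of the group of linear symmetries of a form of degree at least `3` without
multiple factors is trivial: its elements are linear, and they are also smooth multiples of a
Hamiltonian field of degree at least `2`. -/
theorem eq_zero_of_infinitesimal_symmetry {g : MvPolynomial (Fin 2) ℝ} {n : ℕ} (hn : 3 ≤ n)
    (hg : g.IsHomogeneous n) (hsq : Squarefree g) {M : Plane →L[ℝ] Plane}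
    (hM : ∀ z, polyFun (MvPolynomial.pderiv 0 g) z * (M z).1 +
      polyFun (MvPolynomial.pderiv 1 g) z * (M z).2 = 0) : M = 0 := by
  obtain ⟨b, hb, hMb⟩ := exists_eq_smul_hamiltonian (by omega) hg hsq M.contDiff hM
  refine ContinuousLinearMap.ext fun z => ?_
  have hbc := hb.continuous
  have h := Continuous.ext_on (dense_compl_singleton (0 : ℝ)) (continuous_const (y := M z))
    (by fun_prop : Continuous fun t : ℝ => t ^ (n - 2) • b (t • z) • hamiltonian g z)
    (fun t ht => by
      have ht0 : t ≠ 0 := ht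
      have h1 := hMb (t • z)
      rw [map_smul, hamiltonian_smul hg, show n - 1 = (n - 2) + 1 by omega, pow_succ', mul_smul,
        smul_comm] at h1
      rw [smul_right_injective Plane ht0 h1, smul_comm])
  have h0 := congrFun h 0
  simpa [show n - 2 ≠ 0 by omega] using h0

/-- The identity is isolated among the linear symmetries of a form of degree at least `3` without
multiple factors. -/
theorem eventually_linear_symmetry_eq_id {g : MvPolynomial (Fin 2) ℝ} {n : ℕ} (hn : 3 ≤ n)
    (hg : g.IsHomogeneous n) (hsq : Squarefree g) :
    ∀ᶠ L in 𝓝 (ContinuousLinearMap.id ℝ Plane),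
      (∀ z, polyFun g (L z) = polyFun g z) → L = ContinuousLinearMap.id ℝ Plane := by
  by_contra hcon
  rw [not_eventually] at hcon
  obtain ⟨L, hL, hLp⟩ := exists_seq_forall_of_frequently hcon
  simp only [Classical.not_imp] at hLp
  set I := ContinuousLinearMap.id ℝ Plane with hI
  have hε : ∀ j, ‖L j - I‖ ≠ 0 := fun j => norm_ne_zero_iff.2 (sub_ne_zero.2 (hLp j).2)
  -- normalized differences accumulate at an infinitesimal symmetry of norm one
  have hS : ∀ j, ‖L j - I‖⁻¹ • (L j - I) ∈ Metric.sphere (0 : Plane →L[ℝ] Plane) 1 := fun j => by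
    rw [mem_sphere_zero_iff_norm, norm_smul, norm_inv, norm_norm, inv_mul_cancel₀ (hε j)]
  obtain ⟨M, hM, φ, hφ, hlim⟩ := (isCompact_sphere (0 : Plane →L[ℝ] Plane) 1).tendsto_subseq hS
  have hM0 : M = 0 := by
    refine eq_zero_of_infinitesimal_symmetry hn hg hsq fun z => ?_
    have hd := (hasFDerivAt_polyFun g z).hasFDerivWithinAt (s := univ)
    have hev : ∀ T : Plane →L[ℝ] Plane, Tendsto (fun A : Plane →L[ℝ] Plane => A z) (𝓝 T)
        (𝓝 (T z)) := fun T => (ContinuousLinearMap.apply ℝ Plane z).continuous.tendsto T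
    have hsub : Tendsto (fun j => L (φ j) - I) atTop (𝓝 0) := by
      simpa using (hL.comp hφ.tendsto_atTop).sub_const I
    have h1 : Tendsto (fun j => (L (φ j) - I) z) atTop (𝓝 0) := (hev 0).comp hsub
    have h3 : Tendsto (fun j => ‖L (φ j) - I‖⁻¹ • (L (φ j) - I) z) atTop (𝓝 (M z)) :=
      (hev M).comp hlim
    have h4 := hd.lim h1 (by simp) h3
    have h5 : ∀ j, ‖L (φ j) - I‖⁻¹ • (polyFun g (z + (L (φ j) - I) z) - polyFun g z) = 0 := by
      intro j
      have : z + (L (φ j) - I) z = L (φ j) z := by simp [hI]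
      rw [this, (hLp (φ j)).1 z, sub_self, smul_zero]
    simp only [h5] at h4
    simpa using (tendsto_nhds_unique h4 tendsto_const_nhds)
  rw [hM0] at hM
  simp at hM

/-- The symmetries met along the path form a connected set, in which the identity is isolated. -/
theorem linear_symmetry_path_eq_id {g : MvPolynomial (Fin 2) ℝ} {n : ℕ} (hn : 3 ≤ n)
    (hg : g.IsHomogeneous n) (hsq : Squarefree g) {L : ℝ → Plane →L[ℝ] Plane}
    (hL : ContinuousOn L (Icc 0 1)) (hL0 : L 0 = ContinuousLinearMap.id ℝ Plane)
    (hgL : ∀ t ∈ Icc (0 : ℝ) 1, ∀ z, polyFun g (L t z) = polyFun g z) :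
    L 1 = ContinuousLinearMap.id ℝ Plane := by
  set I := ContinuousLinearMap.id ℝ Plane with hI
  obtain ⟨δ, hδ, h⟩ := Metric.eventually_nhds_iff_ball.1
    (eventually_linear_symmetry_eq_id hn hg hsq)
  have hsub : L '' Icc 0 1 ⊆ Metric.ball I (δ / 2) := by
    refine (isPreconnected_Icc.image L hL).subset_of_closure_inter_subset Metric.isOpen_ball
      ⟨I, ⟨0, by simp, hL0⟩, Metric.mem_ball_self (by positivity)⟩ ?_
    rintro _ ⟨hcl, t, ht, rfl⟩
    have : L t ∈ Metric.ball I δ :=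
      Metric.closedBall_subset_ball (by linarith) (Metric.closure_ball_subset_closedBall hcl)
    rw [h _ this (hgL t ht)]
    exact Metric.mem_ball_self (by positivity)
  have h1 : L 1 ∈ Metric.ball I δ :=
    Metric.ball_subset_ball (by linarith) (hsub ⟨1, by simp, rfl⟩)
  exact h _ h1 (hgL 1 (by simp))

/-! ### Quadratic forms -/

theorem eq_zero_of_hamiltonian_eq_zero {g : MvPolynomial (Fin 2) ℝ} {n : ℕ} (hn : 2 ≤ n)
    (hg : g.IsHomogeneous n) (hsq : Squarefree g) {z : Plane} (hz : hamiltonian g z = 0) :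
    z = 0 := by
  rw [hamiltonian_eq, Prod.mk_eq_zero, neg_eq_zero] at hz
  obtain ⟨A, B, m, hAB⟩ := exists_bezout_pderiv (by omega) hg hsq
  have h1 : polyFun A z * polyFun (MvPolynomial.pderiv 0 g) z +
      polyFun B z * polyFun (MvPolynomial.pderiv 1 g) z = z.2 ^ m := by
    have := congrArg (fun r => polyFun r z) hAB
    simpa [polyFun] using this
  rw [hz.1, hz.2, mul_zero, mul_zero, add_zero] at h1
  obtain ⟨x, y⟩ := z
  obtain rfl : y = 0 := eq_zero_of_pow_eq_zero h1.symm
  by_contra hne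
  exact pderiv_ne_zero_on_axis hn hg hsq (fun hx => hne (by simp [hx])) hz.2 hz.1

theorem exists_quadratic_coeff {g : MvPolynomial (Fin 2) ℝ} (hg : g.IsHomogeneous 2)
    (hsq : Squarefree g) :
    ∃ a b c : ℝ, 4 * a * c - b ^ 2 ≠ 0 ∧
      (∀ z, polyFun g z = a * z.1 ^ 2 + b * z.1 * z.2 + c * z.2 ^ 2) ∧
      ∀ z, hamiltonian g z = (-(b * z.1 + 2 * c * z.2), 2 * a * z.1 + b * z.2) := by
  obtain ⟨a, b, c, hgf⟩ : ∃ a b c : ℝ,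
      ∀ z, polyFun g z = a * z.1 ^ 2 + b * z.1 * z.2 + c * z.2 ^ 2 := by
    refine ⟨(dehomogenize g).coeff 2, (dehomogenize g).coeff 1, (dehomogenize g).coeff 0,
      fun z => ?_⟩
    conv_lhs => rw [← homogenize_dehomogenize hg]
    simp only [polyFun, Polynomial.homogenize, Finset.Nat.antidiagonal_succ,
      Finset.Nat.antidiagonal_zero, Finset.map_singleton, Finset.sum_cons, Finset.sum_singleton,
      Finset.map_cons, map_add, MvPolynomial.eval_monomial]
    simp [Finsupp.prod_fintype]
    ring
  have hH : ∀ z, hamiltonian g z = (-(b * z.1 + 2 * c * z.2), 2 * a * z.1 + b * z.2) := by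
    intro z
    have d1 := hasFDerivAt_polyFun g z
    rw [show polyFun g = fun z => a * z.1 ^ 2 + b * z.1 * z.2 + c * z.2 ^ 2 from funext hgf] at d1
    have x1 := hasFDerivAt_fst (𝕜 := ℝ) (p := z)
    have x2 := hasFDerivAt_snd (𝕜 := ℝ) (p := z)
    have d2 := (((x1.pow 2).const_mul a).add ((x1.const_mul b).mul x2)).add ((x2.pow 2).const_mul c)
    have e := d1.unique d2
    have e0 := congrArg (fun A : Plane →L[ℝ] ℝ => A (1, 0)) e
    have e1 := congrArg (fun A : Plane →L[ℝ] ℝ => A (0, 1)) e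
    simp at e0 e1
    rw [hamiltonian_eq, e0, e1]
    ext <;> simp <;> ring
  refine ⟨a, b, c, fun hD => ?_, hgf, hH⟩
  have h1 := eq_zero_of_hamiltonian_eq_zero le_rfl hg hsq (z := (b, -(2 * a))) (by
    rw [hH]; ext <;> simp <;> linarith)
  have h2 := eq_zero_of_hamiltonian_eq_zero le_rfl hg hsq (z := (2 * c, -b)) (by
    rw [hH]; ext <;> simp <;> linarith)
  have h3 := eq_zero_of_hamiltonian_eq_zero le_rfl hg hsq (z := (1, 0)) (by
    simp only [Prod.mk_eq_zero, neg_eq_zero] at h1 h2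
    rw [hH]; ext <;> simp <;> linarith)
  simp at h3

theorem pos_of_ne_zero_on_Icc {f : ℝ → ℝ} (hf : ContinuousOn f (Icc 0 1)) (h0 : 0 < f 0)
    (hne : ∀ t ∈ Icc (0 : ℝ) 1, f t ≠ 0) : ∀ t ∈ Icc (0 : ℝ) 1, 0 < f t := by
  intro t ht
  by_contra hlt
  obtain ⟨s, hs, hs0⟩ := isPreconnected_Icc.intermediate_value ht
    (show (0 : ℝ) ∈ Icc 0 1 by simp) hf ⟨not_lt.1 hlt, h0.le⟩
  exact hne s hs hs0

theorem det_sq_of_linear_symmetry {a b c p q r s : ℝ}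
    (h1 : a * p ^ 2 + b * p * r + c * r ^ 2 = a)
    (h2 : 2 * a * p * q + b * (p * s + q * r) + 2 * c * r * s = b)
    (h3 : a * q ^ 2 + b * q * s + c * s ^ 2 = c) :
    (4 * a * c - b ^ 2) * (p * s - q * r) ^ 2 = 4 * a * c - b ^ 2 := by
  linear_combination 4 * (a * q ^ 2 + b * q * s + c * s ^ 2) * h1 + 4 * a * h3 -
    (2 * a * p * q + b * (p * s + q * r) + 2 * c * r * s + b) * h2

/-- A linear symmetry of determinant one of a nondegenerate quadratic form commutes with the
Hamiltonian field, hence is a combination of the identity and the latter. -/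
theorem linear_symmetry_eq_combination {a b c : ℝ} (hD : 4 * a * c - b ^ 2 ≠ 0)
    {p q r s : ℝ} (h1 : a * p ^ 2 + b * p * r + c * r ^ 2 = a)
    (h2 : 2 * a * p * q + b * (p * s + q * r) + 2 * c * r * s = b)
    (h3 : a * q ^ 2 + b * q * s + c * s ^ 2 = c) (hdet : p * s - q * r = 1) :
    ∃ v : ℝ, p = (p + s) / 2 - v * b ∧ q = -(2 * c * v) ∧ r = 2 * a * v ∧
      s = (p + s) / 2 + v * b ∧ ((p + s) / 2) ^ 2 + (4 * a * c - b ^ 2) * v ^ 2 = 1 := by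
  have t1 : 2 * a * (p - s) = -(2 * b * r) := by
    linear_combination 2 * s * h1 - r * h2 - (2 * a * p + b * r) * hdet
  have t2 : a * q = -(c * r) := by
    linear_combination (s * h2 - 2 * r * h3 - (2 * a * q + b * s) * hdet) / 2
  have t3 : c * (p - s) = b * q := by
    linear_combination (q * h2 - 2 * p * h3 + (b * q + 2 * c * s) * hdet) / 2
  suffices ∃ v : ℝ, p - s = -(2 * v * b) ∧ q = -(2 * c * v) ∧ r = 2 * a * v by
    obtain ⟨v, e1, e2, e3⟩ := this
    refine ⟨v, by linarith, e2, e3, by linarith, ?_⟩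
    have : 1 = ((p + s) / 2) ^ 2 - ((p - s) / 2) ^ 2 - q * r := by linear_combination -hdet
    rw [this, e1, e2, e3]
    ring
  by_cases ha : a = 0
  · by_cases hc : c = 0
    · subst ha hc
      have hb : b ≠ 0 := by rintro rfl; simp at hD
      have hr : r = 0 := by
        have : b * r = 0 := by linarith
        exact (mul_eq_zero.1 this).resolve_left hb
      have hq : q = 0 := by
        have : b * q = 0 := by linarith
        exact (mul_eq_zero.1 this).resolve_left hb
      exact ⟨-(p - s) / (2 * b), by field_simp, by simp [hq], by simp [hr]⟩
    · subst ha
      have hr : r = 0 := by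
        have : c * r = 0 := by linarith
        exact (mul_eq_zero.1 this).resolve_left hc
      refine ⟨-q / (2 * c), ?_, by field_simp, by simp [hr]⟩
      field_simp
      linarith
  · refine ⟨r / (2 * a), ?_, ?_, by field_simp⟩
    · field_simp
      linarith
    · field_simp
      linarith

/-- A path of linear symmetries of a nondegenerate quadratic form starting at the identity ends at
a combination `u + v J` of the identity and the Hamiltonian field `J`, on the component of the
identity of the conic `u ^ 2 + D v ^ 2 = 1`. -/
theorem linear_symmetry_path_quadratic {g : MvPolynomial (Fin 2) ℝ} {a b c : ℝ}
    (hD : 4 * a * c - b ^ 2 ≠ 0)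
    (hgf : ∀ z, polyFun g z = a * z.1 ^ 2 + b * z.1 * z.2 + c * z.2 ^ 2)
    (hH : ∀ z, hamiltonian g z = (-(b * z.1 + 2 * c * z.2), 2 * a * z.1 + b * z.2))
    {L : ℝ → Plane →L[ℝ] Plane}
    (hL : ContinuousOn L (Icc 0 1)) (hL0 : L 0 = ContinuousLinearMap.id ℝ Plane)
    (hgL : ∀ t ∈ Icc (0 : ℝ) 1, ∀ z, polyFun g (L t z) = polyFun g z) :
    ∃ u v : ℝ, (∀ z, L 1 z = u • z + v • hamiltonian g z) ∧
      u ^ 2 + (4 * a * c - b ^ 2) * v ^ 2 = 1 ∧ (4 * a * c - b ^ 2 < 0 → 0 < u) := by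
  have hcont : ∀ w, ContinuousOn (fun t => L t w) (Icc 0 1) := fun w =>
    hL.clm_apply continuousOn_const
  have hLz : ∀ t, ∀ z : Plane, L t z = z.1 • L t (1, 0) + z.2 • L t (0, 1) := fun t z => by
    rw [← map_smul, ← map_smul, ← map_add]
    congr 1
    ext <;> simp
  have e1 : ∀ t ∈ Icc (0 : ℝ) 1, a * (L t (1, 0)).1 ^ 2 + b * (L t (1, 0)).1 * (L t (1, 0)).2 +
      c * (L t (1, 0)).2 ^ 2 = a := fun t ht => by
    have := hgL t ht (1, 0)
    rw [hgf, hgf] at this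
    simpa using this
  have e3 : ∀ t ∈ Icc (0 : ℝ) 1, a * (L t (0, 1)).1 ^ 2 + b * (L t (0, 1)).1 * (L t (0, 1)).2 +
      c * (L t (0, 1)).2 ^ 2 = c := fun t ht => by
    have := hgL t ht (0, 1)
    rw [hgf, hgf] at this
    simpa using this
  have e2 : ∀ t ∈ Icc (0 : ℝ) 1, 2 * a * (L t (1, 0)).1 * (L t (0, 1)).1 +
      b * ((L t (1, 0)).1 * (L t (0, 1)).2 + (L t (0, 1)).1 * (L t (1, 0)).2) +
      2 * c * (L t (1, 0)).2 * (L t (0, 1)).2 = b := fun t ht => by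
    have := hgL t ht (1, 1)
    rw [hgf, hgf, hLz] at this
    simp only [Prod.fst_add, Prod.snd_add, Prod.smul_fst, Prod.smul_snd, smul_eq_mul] at this
    linear_combination this - e1 t ht - e3 t ht
  let d : ℝ → ℝ := fun t => (L t (1, 0)).1 * (L t (0, 1)).2 - (L t (0, 1)).1 * (L t (1, 0)).2
  have hd2 : ∀ t ∈ Icc (0 : ℝ) 1, d t ^ 2 = 1 := fun t ht => by
    have := det_sq_of_linear_symmetry (e1 t ht) (e2 t ht) (e3 t ht)
    exact mul_left_cancel₀ hD (by rw [mul_one]; exact this)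
  have hdc : ContinuousOn d (Icc 0 1) :=
    ((hcont _).fst.mul (hcont _).snd).sub ((hcont _).fst.mul (hcont _).snd)
  have hd : ∀ t ∈ Icc (0 : ℝ) 1, d t = 1 := fun t ht => by
    have hpos := pos_of_ne_zero_on_Icc hdc (by simp [d, hL0]) (fun t ht h0 => by
      have := hd2 t ht
      rw [h0] at this
      norm_num at this) t ht
    nlinarith [hd2 t ht]
  have key := fun t ht => linear_symmetry_eq_combination hD (e1 t ht) (e2 t ht) (e3 t ht) (hd t ht)
  obtain ⟨v, k1, k2, k3, k4, k5⟩ := key 1 (by simp)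
  refine ⟨_, v, fun z => ?_, k5, fun hneg => ?_⟩
  · rw [hLz, hH]
    ext
    · simp only [Prod.fst_add, Prod.smul_fst, smul_eq_mul]
      linear_combination z.1 * k1 + z.2 * k2
    · simp only [Prod.snd_add, Prod.smul_snd, smul_eq_mul]
      linear_combination z.1 * k3 + z.2 * k4
  · refine pos_of_ne_zero_on_Icc (f := fun t => ((L t (1, 0)).1 + (L t (0, 1)).2) / 2)
      (((hcont _).fst.add (hcont _).snd).div_const 2) (by simp [hL0]) (fun t ht h0 => ?_) 1 (by simp)
    obtain ⟨v', -, -, -, -, k5'⟩ := key t ht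
    rw [h0] at k5'
    nlinarith [sq_nonneg v']

/-- A smooth parametrization, by a multiple of the time, of the one-parameter group on the conic
`u ^ 2 + D v ^ 2 = 1`. -/
theorem exists_conic_path {D u v : ℝ} (hD : D ≠ 0) (huv : u ^ 2 + D * v ^ 2 = 1)
    (hu : D < 0 → 0 < u) :
    ∃ (C S : ℝ → ℝ) (l : ℝ), ContDiff ℝ ∞ C ∧ ContDiff ℝ ∞ S ∧
      (∀ t, HasDerivAt C (-(l * D * S t)) t) ∧ (∀ t, HasDerivAt S (l * C t) t) ∧
      C 0 = 1 ∧ S 0 = 0 ∧ C 1 = u ∧ S 1 = v := by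
  rcases lt_or_gt_of_ne hD with h | h
  · set d := √(-D) with hd
    have hd0 : d ≠ 0 := (Real.sqrt_pos.2 (by linarith)).ne'
    have hdd : D = -(d * d) := by rw [Real.mul_self_sqrt (by linarith)]; ring
    set θ := Real.arsinh (d * v)
    have hlin : ∀ t : ℝ, HasDerivAt (fun t => θ * t) θ t := fun t => by
      simpa using (hasDerivAt_id t).const_mul θ
    refine ⟨fun t => Real.cosh (θ * t), fun t => Real.sinh (θ * t) / d, θ / d, ?_, ?_, fun t => ?_,
      fun t => ?_, by simp, by simp, ?_, ?_⟩
    · exact Real.contDiff_cosh.comp (by fun_prop)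
    · exact (Real.contDiff_sinh.comp (by fun_prop)).div_const d
    · refine ((Real.hasDerivAt_cosh _).comp t (hlin t)).congr_deriv ?_
      rw [hdd]
      field_simp
    · refine (((Real.hasDerivAt_sinh _).comp t (hlin t)).div_const d).congr_deriv ?_
      field_simp
    · simp only [mul_one, θ, Real.cosh_arsinh]
      rw [show 1 + (d * v) ^ 2 = u ^ 2 by rw [← huv, hdd]; ring]
      exact Real.sqrt_sq (hu h).le
    · simp only [mul_one, θ, Real.sinh_arsinh]
      field_simp
  · set d := √D with hd
    have hd0 : d ≠ 0 := (Real.sqrt_pos.2 h).ne'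
    have hdd : D = d * d := (Real.mul_self_sqrt h.le).symm
    set w : ℂ := ⟨u, d * v⟩ with hw
    have hw1 : ‖w‖ = 1 := by
      rw [← sq_eq_sq₀ (norm_nonneg _) zero_le_one, Complex.sq_norm, Complex.normSq_apply]
      rw [hdd] at huv
      simp only [hw]
      linear_combination huv
    set θ := Complex.arg w
    have hcos : Real.cos θ = u := by simpa [hw1] using Complex.norm_mul_cos_arg w
    have hsin : Real.sin θ = d * v := by simpa [hw1] using Complex.norm_mul_sin_arg w
    have hlin : ∀ t : ℝ, HasDerivAt (fun t => θ * t) θ t := fun t => by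
      simpa using (hasDerivAt_id t).const_mul θ
    refine ⟨fun t => Real.cos (θ * t), fun t => Real.sin (θ * t) / d, θ / d, ?_, ?_, fun t => ?_,
      fun t => ?_, by simp, by simp, by simpa using hcos, ?_⟩
    · exact Real.contDiff_cos.comp (by fun_prop)
    · exact (Real.contDiff_sin.comp (by fun_prop)).div_const d
    · refine ((Real.hasDerivAt_cos _).comp t (hlin t)).congr_deriv ?_
      rw [hdd]
      field_simp
    · refine (((Real.hasDerivAt_sin _).comp t (hlin t)).div_const d).congr_deriv ?_
      field_simp
    · simp only [mul_one, hsin]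
      field_simp

/-- A symmetry of the form `g` whose linear part is joined to the identity by linear symmetries is
itself joined to the identity by an isotopy with velocity a smooth multiple of the Hamiltonian
field.  In degree at least `3` the linear part is the identity; in degree `2` it belongs to the
flow of the (linear) Hamiltonian field, and one composes the isotopy with that flow. -/
theorem exists_hamiltonian_path {g : MvPolynomial (Fin 2) ℝ} {n : ℕ} (hn : 2 ≤ n)
    (hg : g.IsHomogeneous n) (hsq : Squarefree g) {h : Plane → Plane} (hh : ContDiff ℝ ∞ h)
    (hh0 : h 0 = 0) (hgh : ∀ᶠ z in 𝓝 (0 : Plane), polyFun g (h z) = polyFun g z)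
    {L : ℝ → Plane →L[ℝ] Plane} (hL : ContinuousOn L (Icc 0 1))
    (hL0 : L 0 = ContinuousLinearMap.id ℝ Plane) (hL1 : HasFDerivAt h (L 1) 0)
    (hgL : ∀ t ∈ Icc (0 : ℝ) 1, ∀ z, polyFun g (L t z) = polyFun g z) :
    ∃ (K : ℝ × Plane → Plane) (β : ℝ × Plane → ℝ), ContDiff ℝ ∞ K ∧ ContDiff ℝ ∞ β ∧
      (∀ t, K (t, 0) = 0) ∧ (∀ z, K (0, z) = z) ∧ (∀ z, K (1, z) = h z) ∧
      ∀ᶠ z in 𝓝 (0 : Plane), ∀ t ∈ Icc (0 : ℝ) 1,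
        HasDerivAt (fun t => K (t, z)) (β (t, z) • hamiltonian g (K (t, z))) t := by
  rcases eq_or_lt_of_le hn with rfl | hn3
  · obtain ⟨a, b, c, hD, hgf, hH⟩ := exists_quadratic_coeff hg hsq
    obtain ⟨u, v, hLuv, huv, hu⟩ := linear_symmetry_path_quadratic hD hgf hH hL hL0 hgL
    obtain ⟨C, S, l, hC, hS, hC', hS', hC0, hS0, hC1, hS1⟩ := exists_conic_path hD huv hu
    set D := 4 * a * c - b ^ 2 with hDdef
    set J := hamiltonian g with hJ
    have hJc : ContDiff ℝ ∞ J := contDiff_hamiltonian g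
    have hJlin : ∀ (x y : ℝ) (z w : Plane), J (x • z + y • w) = x • J z + y • J w := by
      intro x y z w
      rw [hH, hH, hH]
      ext <;> simp <;> ring
    have hJJ : ∀ z, J (J z) = -(D • z) := by
      intro z
      rw [hH, hH]
      ext <;> simp [hDdef] <;> ring
    have hgJ : ∀ (x y : ℝ) (z : Plane),
        polyFun g (x • z + y • J z) = (x ^ 2 + D * y ^ 2) * polyFun g z := by
      intro x y z
      rw [hgf, hgf, hH]
      simp [hDdef]
      ring
    have hJd : ∀ z : Plane, HasFDerivAt J (fderiv ℝ J 0) z := by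
      intro z
      let Jl : Plane →L[ℝ] Plane := LinearMap.toContinuousLinearMap
        { toFun := J
          map_add' := fun z w => by simpa using hJlin 1 1 z w
          map_smul' := fun x z => by simpa using hJlin x 0 z 0 }
      have hd : ∀ w, HasFDerivAt J Jl w := fun w => Jl.hasFDerivAt
      rw [(hd 0).fderiv]
      exact hd z
    have hJ' : ∀ z, fderiv ℝ J 0 z = J z := by
      intro z
      have h1 := (hJd 0).lim z (c := fun c : ℝ => c) tendsto_norm_atTop_atTop
      have h2 : J 0 = 0 := by simpa using hJlin 0 0 0 0
      refine tendsto_nhds_unique h1 (Tendsto.congr' ?_ tendsto_const_nhds)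
      filter_upwards [eventually_gt_atTop (0 : ℝ)] with c hc
      have h3 : J (c⁻¹ • z) = c⁻¹ • J z := by simpa using hJlin c⁻¹ 0 z 0
      simp only [zero_add, h2, sub_zero]
      rw [h3, smul_smul, mul_inv_cancel₀ hc.ne', one_smul]
    -- undo the linear part of `h`
    let k : Plane → Plane := fun z => u • h z + (-v) • J (h z)
    have hJ0 : J 0 = 0 := by simpa using hJlin 0 0 0 0
    have hkd : HasFDerivAt k (ContinuousLinearMap.id ℝ Plane) 0 := by
      have d1 := (hL1.const_smul u).add (((hJd (h 0)).comp 0 hL1).const_smul (-v))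
      refine d1.congr_fderiv (ContinuousLinearMap.ext fun z => ?_)
      change u • L 1 z + (-v) • fderiv ℝ J 0 (L 1 z) = z
      rw [hJ', hLuv, hJlin, hJJ]
      have : u • (u • z + v • J z) + (-v) • (u • J z + v • -(D • z)) =
          (u ^ 2 + D * v ^ 2) • z := by module
      rw [this, huv, one_smul]
    have hgk : ∀ᶠ z in 𝓝 (0 : Plane), polyFun g (k z) = polyFun g z := by
      filter_upwards [hgh] with z hz
      rw [hgJ, neg_sq, huv, one_mul, hz]
    have hk : ContDiff ℝ ∞ k := (hh.const_smul u).add ((hJc.comp hh).const_smul (-v))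
    obtain ⟨K, β, hK, hβ, hKt, hK0, hK1, hode⟩ := exists_hamiltonian_path_of_tangent_to_id hn hg hsq
      hk (by simp [k, hh0, hJ0]) hkd hgk
    refine ⟨fun q => C q.1 • K q + S q.1 • J (K q), fun q => l + β q, ?_, contDiff_const.add hβ,
      fun t => by simp [hKt, hJ0], fun z => by simp [hK0, hC0, hS0], fun z => ?_, ?_⟩
    · exact ((hC.comp contDiff_fst).smul hK).add ((hS.comp contDiff_fst).smul (hJc.comp hK))
    · simp only [hC1, hS1, hK1, k]
      rw [hJlin, hJJ]
      have : u • (u • h z + (-v) • J (h z)) + v • (u • J (h z) + (-v) • -(D • h z)) =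
          (u ^ 2 + D * v ^ 2) • h z := by module
      rw [this, huv, one_smul]
    · filter_upwards [hode] with z hz t ht
      have d1 := hz t ht
      have d2 : HasDerivAt (fun t => J (K (t, z))) (β (t, z) • J (J (K (t, z)))) t := by
        have := (hJd (K (t, z))).comp_hasDerivAt t d1
        rwa [map_smul, hJ'] at this
      refine (((hC' t).smul d1).add ((hS' t).smul d2)).congr_deriv ?_
      rw [hJlin, hJJ]
      module
  · have hid := linear_symmetry_path_eq_id hn3 hg hsq hL hL0 hgL
    rw [hid] at hL1
    exact exists_hamiltonian_path_of_tangent_to_id hn hg hsq hh hh0 hL1 hgh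

/-! ### Isotopies along orbits preserve the first integral -/

theorem exists_countable_cofinal (I : Set ℝ) :
    ∃ T ⊆ I, T.Countable ∧ ∀ t ∈ I, ∃ t' ∈ T, t ≤ t' := by
  classical
  let Q : Set ℚ := {q | ∃ t ∈ I, (q : ℝ) < t}
  have hQ : ∀ q : Q, ∃ t ∈ I, ((q : ℚ) : ℝ) < t := fun q => q.2
  choose f hfI hf using hQ
  refine ⟨range f ∪ {t ∈ I | ∀ s ∈ I, s ≤ t}, ?_, ?_, fun t ht => ?_⟩
  · rintro t (⟨q, rfl⟩ | h)
    · exact hfI q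
    · exact h.1
  · refine (countable_range f).union (Set.Subsingleton.countable ?_)
    exact fun s hs t ht => le_antisymm (ht.2 s hs.1) (hs.2 t ht.1)
  · by_cases hmax : ∀ s ∈ I, s ≤ t
    · exact ⟨t, Or.inr ⟨ht, hmax⟩, le_rfl⟩
    · push Not at hmax
      obtain ⟨s, hs, hts⟩ := hmax
      obtain ⟨q, hq1, hq2⟩ := exists_rat_btwn hts
      exact ⟨f ⟨q, s, hs, hq2⟩, Or.inl ⟨_, rfl⟩, hq1.le.trans (hf ⟨q, s, hs, hq2⟩).le⟩

theorem countable_image_of_locally_const {c : ℝ → ℝ} {T : Set ℝ}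
    (hc : ∀ t ∈ T, ∀ᶠ s in 𝓝[T] t, c s = c t) : (c '' T).Countable := by
  obtain ⟨A, -, hA, hTA⟩ := TopologicalSpace.countable_cover_nhdsWithin
    (f := fun t => {s | c s = c t}) (s := T) hc
  refine (hA.image c).mono ?_
  rintro _ ⟨t, ht, rfl⟩
  obtain ⟨s, hs, hts⟩ := mem_iUnion₂.1 (hTA ht)
  exact ⟨s, hs, hts.symm⟩

theorem FlowsTo.apply_eq_of_mem_uIcc {G : Plane → Plane} (hG : ContDiff ℝ ∞ G) {z w : Plane}
    {s t : ℝ} {γ : ℝ → Plane} (h0 : γ 0 = z) (hγ : IsIntegralCurveOn γ (fun _ => G) (uIcc 0 t))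
    (hs : s ∈ uIcc 0 t) (h : FlowsTo G z s w) : γ s = w :=
  FlowsTo.unique hG ⟨γ, h0, rfl, hγ.mono (uIcc_subset_uIcc_left hs)⟩ h

section Chart

variable {G : Plane → Plane} {η : Plane → ℝ} {e : OpenPartialHomeomorph Plane Plane}
  {g : MvPolynomial (Fin 2) ℝ}

theorem hasFDerivAt_chart (he : IsSmoothLocalDiffeo e) {z : Plane} (hz : z ∈ e.source) :
    HasFDerivAt e (fderiv ℝ e z) z :=
  ((he.smooth.contDiffAt (e.open_source.mem_nhds hz)).differentiableAt (by simp)).hasFDerivAt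

theorem hasFDerivAt_chart_symm (he : IsSmoothLocalDiffeo e) {z : Plane} (hz : z ∈ e.target) :
    HasFDerivAt e.symm (fderiv ℝ e.symm z) z :=
  ((he.smooth_symm.contDiffAt (e.open_target.mem_nhds hz)).differentiableAt
    (by simp)).hasFDerivAt

theorem fderiv_chart_symm_apply (he : IsSmoothLocalDiffeo e) {z : Plane} (hz : z ∈ e.source)
    (w : Plane) : fderiv ℝ e.symm (e z) (fderiv ℝ e z w) = w := by
  have d1 := (hasFDerivAt_chart_symm he (e.map_source hz)).comp z (hasFDerivAt_chart he hz)
  have d2 : HasFDerivAt (e.symm ∘ e) (ContinuousLinearMap.id ℝ Plane) z :=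
    (hasFDerivAt_id z).congr_of_eventuallyEq (e.eventually_left_inverse hz)
  exact congrArg (fun A : Plane →L[ℝ] Plane => A w) (d1.unique d2)

theorem fderiv_chart_apply_symm (he : IsSmoothLocalDiffeo e) {z : Plane} (hz : z ∈ e.source)
    (w : Plane) : fderiv ℝ e z (fderiv ℝ e.symm (e z) w) = w := by
  have hz' := e.map_source hz
  have d0 := hasFDerivAt_chart he (e.map_target hz')
  have d1 := d0.comp (e z) (hasFDerivAt_chart_symm he hz')
  have d2 : HasFDerivAt (e ∘ e.symm) (ContinuousLinearMap.id ℝ Plane) (e z) :=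
    (hasFDerivAt_id (e z)).congr_of_eventuallyEq (e.eventually_right_inverse hz')
  have := congrArg (fun A : Plane →L[ℝ] Plane => A w) (d1.unique d2)
  rw [e.left_inv hz] at this
  exact this

theorem IsSmoothLocalDiffeo.zero_mem_target (he : IsSmoothLocalDiffeo e) :
    (0 : Plane) ∈ e.target := by
  simpa [he.map_zero] using e.map_source he.zero_mem

theorem IsSmoothLocalDiffeo.symm_zero (he : IsSmoothLocalDiffeo e) : e.symm 0 = 0 := by
  simpa [he.map_zero] using e.left_inv he.zero_mem

/-- The first integral `g ∘ e` takes only countably many values on the part of an orbit in the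
domain of the chart `e`: it is locally constant along the trajectory. -/
theorem countable_firstIntegral_orbit (hG : ContDiff ℝ ∞ G) (he : IsSmoothLocalDiffeo e)
    (hstar : ∀ z ∈ e.source, fderiv ℝ e z (G z) = η z • hamiltonian g (e z)) (z : Plane) :
    ((fun w => polyFun g (e w)) '' (orbit G z ∩ e.source)).Countable := by
  let I : Set ℝ := {t | ∃ w, FlowsTo G z t w}
  have hI : ∀ t ∈ I, ((fun w => polyFun g (e w)) ''
      ({w | ∃ s ∈ uIcc 0 t, FlowsTo G z s w} ∩ e.source)).Countable := by
    rintro t ⟨_, γ, h0, -, hγ⟩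
    have hcount : ((fun s => polyFun g (e (γ s))) '' (uIcc 0 t ∩ γ ⁻¹' e.source)).Countable := by
      refine countable_image_of_locally_const ?_
      rintro s ⟨hs, hsrc⟩
      have h1 : ∀ᶠ r in 𝓝[uIcc 0 t] s, γ r ∈ e.source :=
        (hγ.continuousOn s hs) (e.open_source.mem_nhds hsrc)
      rw [eventually_nhdsWithin_iff, Metric.eventually_nhds_iff_ball] at h1
      obtain ⟨ε, hε, h1⟩ := h1
      rw [eventually_nhdsWithin_iff]
      filter_upwards [Metric.ball_mem_nhds s hε] with r hr hr'
      have hd : ∀ q ∈ Metric.ball s ε ∩ uIcc 0 t,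
          HasDerivWithinAt (fun s => polyFun g (e (γ s))) 0 (Metric.ball s ε ∩ uIcc 0 t) q := by
        rintro q ⟨hq, hq'⟩
        have hqs := h1 q hq hq'
        have d1 := (hasFDerivAt_polyFun g (e (γ q))).comp (γ q) (hasFDerivAt_chart he hqs)
        have d2 : HasDerivWithinAt γ (G (γ q)) (uIcc 0 t) q := hγ q hq'
        refine ((d1.comp_hasDerivWithinAt q d2).mono inter_subset_right).congr_deriv ?_
        rw [ContinuousLinearMap.comp_apply, hstar _ hqs, hamiltonian_eq]
        simp
        ring
      have := ((convex_ball s ε).inter (convex_uIcc 0 t)).norm_image_sub_le_of_norm_hasDerivWithin_le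
        (f' := fun _ => (0 : ℝ)) (C := 0) hd (by simp) ⟨Metric.mem_ball_self hε, hs⟩ ⟨hr, hr'.1⟩
      rw [zero_mul] at this
      exact sub_eq_zero.1 (norm_le_zero_iff.1 this)
    refine hcount.mono ?_
    rintro _ ⟨w, ⟨⟨s, hs, hw⟩, hwsrc⟩, rfl⟩
    have hγs := hw.apply_eq_of_mem_uIcc hG h0 hγ hs
    exact ⟨s, ⟨hs, by rw [mem_preimage, hγs]; exact hwsrc⟩, by simp only [hγs]⟩
  obtain ⟨T, hTI, hT, hTc⟩ := exists_countable_cofinal I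
  obtain ⟨T', hTI', hT', hTc'⟩ := exists_countable_cofinal ((fun t => -t) ⁻¹' I)
  refine ((hT.biUnion fun t ht => hI t (hTI ht)).union
    (hT'.biUnion fun t ht => hI (-t) (hTI' ht))).mono ?_
  rintro _ ⟨w, ⟨⟨s, hs⟩, hw⟩, rfl⟩
  rcases le_total 0 s with h | h
  · obtain ⟨t, ht, hst⟩ := hTc s ⟨w, hs⟩
    refine Or.inl (mem_iUnion₂.2 ⟨t, ht, w, ⟨⟨s, ?_, hs⟩, hw⟩, rfl⟩)
    rw [uIcc_of_le (h.trans hst)]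
    exact ⟨h, hst⟩
  · obtain ⟨t, ht, hst⟩ := hTc' (-s) ⟨w, by simpa using hs⟩
    refine Or.inr (mem_iUnion₂.2 ⟨t, ht, w, ⟨⟨s, ?_, hs⟩, hw⟩, rfl⟩)
    rw [uIcc_of_ge (by linarith)]
    exact ⟨by linarith, h⟩

/-- An isotopy along orbits preserves the first integral `g ∘ e`: along the isotopy the latter is
continuous and takes countably many values. -/
theorem firstIntegral_isotopy (hG : ContDiff ℝ ∞ G) (he : IsSmoothLocalDiffeo e)
    (hstar : ∀ z ∈ e.source, fderiv ℝ e z (G z) = η z • hamiltonian g (e z))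
    {V : Set Plane} (hV : IsOpen V) (h0V : (0 : Plane) ∈ V) {H : ℝ → Plane → Plane}
    (hH0 : ∀ t ∈ Icc (0 : ℝ) 1, H t 0 = 0)
    (hpres : ∀ t ∈ Icc (0 : ℝ) 1, PreservesOrbitsOn G (H t) V)
    (hHc : ContinuousOn (fun q : ℝ × Plane => H q.1 q.2) (Icc (0 : ℝ) 1 ×ˢ V))
    (hid : ∀ z ∈ V, H 0 z = z) :
    ∀ᶠ z in 𝓝 (0 : Plane), ∀ t ∈ Icc (0 : ℝ) 1,
      H t z ∈ e.source ∧ polyFun g (e (H t z)) = polyFun g (e z) := by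
  obtain ⟨O, hO, hOeq⟩ := continuousOn_iff'.1 hHc e.source e.open_source
  obtain ⟨A, B, -, hB, hA, hB0, hAB⟩ := generalized_tube_lemma
    (isCompact_Icc (a := (0 : ℝ)) (b := 1)) (isCompact_singleton (x := (0 : Plane))) hO (by
      rintro ⟨t, z⟩ ⟨ht, hz⟩
      obtain rfl : z = 0 := hz
      have : (t, (0 : Plane)) ∈ (fun q : ℝ × Plane => H q.1 q.2) ⁻¹' e.source ∩
          Icc (0 : ℝ) 1 ×ˢ V := by
        refine ⟨?_, ht, h0V⟩
        change H t 0 ∈ e.source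
        rw [hH0 t ht]
        exact he.zero_mem
      rw [hOeq] at this
      exact this.1)
  filter_upwards [hB.mem_nhds (hB0 rfl), hV.mem_nhds h0V] with z hzB hzV
  have hsrc : ∀ t ∈ Icc (0 : ℝ) 1, H t z ∈ e.source := by
    intro t ht
    have : (t, z) ∈ O ∩ Icc (0 : ℝ) 1 ×ˢ V := ⟨hAB ⟨hA ht, hzB⟩, ht, hzV⟩
    rw [← hOeq] at this
    exact this.1
  have horb : ∀ t ∈ Icc (0 : ℝ) 1, H t z ∈ orbit G z := fun t ht =>
    hpres t ht z ⟨z, ⟨⟨0, FlowsTo.zero hG z⟩, hzV⟩, rfl⟩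
  let c : ℝ → ℝ := fun t => polyFun g (e (H t z))
  have hc : ContinuousOn c (Icc 0 1) := by
    have h1 : ContinuousOn (fun t => H t z) (Icc 0 1) :=
      hHc.comp (f := fun t : ℝ => (t, z)) (by fun_prop) fun t ht => ⟨ht, hzV⟩
    exact (contDiff_polyFun g).continuous.comp_continuousOn
      (e.continuousOn.comp h1 fun t ht => hsrc t ht)
  have hcount : (c '' Icc 0 1).Countable := by
    refine (countable_firstIntegral_orbit (g := g) hG he hstar z).mono ?_
    rintro _ ⟨t, ht, rfl⟩
    exact ⟨H t z, ⟨horb t ht, hsrc t ht⟩, rfl⟩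
  have hsub : (c '' Icc 0 1).Subsingleton :=
    hcount.isTotallyDisconnected _ Subset.rfl (isPreconnected_Icc.image c hc)
  intro t ht
  refine ⟨hsrc t ht, ?_⟩
  have := hsub ⟨t, ht, rfl⟩ ⟨0, by simp, rfl⟩
  simpa only [c, hid z hzV] using this

end Chart

/-! ### The shift function of an isotopy -/

section Chart

variable {G : Plane → Plane} {η : Plane → ℝ} {e : OpenPartialHomeomorph Plane Plane}
  {g : MvPolynomial (Fin 2) ℝ}

theorem apply_zero_of_star {n : ℕ} (hn : 2 ≤ n) (hg : g.IsHomogeneous n)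
    (he : IsSmoothLocalDiffeo e)
    (hstar : ∀ z ∈ e.source, fderiv ℝ e z (G z) = η z • hamiltonian g (e z)) : G 0 = 0 := by
  have hH0 : hamiltonian g 0 = 0 := by
    have := hamiltonian_smul hg 0 0
    rwa [zero_smul, zero_pow (by omega), zero_smul] at this
  have h1 := hstar 0 he.zero_mem
  rw [he.map_zero, hH0, smul_zero] at h1
  rw [← fderiv_chart_symm_apply he he.zero_mem (G 0), h1, map_zero]

/-- Paths moving along the Hamiltonian field in the chart move along `G = η H` with a smooth
velocity factor, whose time integral is the shift function. -/
theorem exists_shift_of_path (hG : ContDiff ℝ ∞ G) (hG0 : G 0 = 0) (hη : ContDiff ℝ ∞ η)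
    (hη0 : ∀ z, η z ≠ 0) (he : IsSmoothLocalDiffeo e)
    (hstar : ∀ z ∈ e.source, fderiv ℝ e z (G z) = η z • hamiltonian g (e z))
    {K : ℝ × Plane → Plane} {β : ℝ × Plane → ℝ} (hK : ContDiff ℝ ∞ K) (hβ : ContDiff ℝ ∞ β)
    (hKt : ∀ t, K (t, 0) = 0) (hK0 : ∀ z, K (0, z) = z)
    (hode : ∀ᶠ z in 𝓝 (0 : Plane), ∀ t ∈ Icc (0 : ℝ) 1,
      HasDerivAt (fun t => K (t, z)) (β (t, z) • hamiltonian g (K (t, z))) t) :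
    ∃ τ : Plane → ℝ, ContDiff ℝ ∞ τ ∧
      ∀ᶠ z in 𝓝 (0 : Plane), FlowsTo G z (τ z) (e.symm (K (1, e z))) := by
  obtain ⟨E, hE, hEe⟩ := exists_contDiff_eventuallyEq e.open_source he.smooth he.zero_mem
  obtain ⟨ζ, hζ, hζe⟩ := exists_contDiff_eventuallyEq e.open_target
    (f := fun y => (η (e.symm y))⁻¹)
    ((hη.comp_contDiffOn he.smooth_symm).inv fun y _ => hη0 _) he.zero_mem_target
  have hE0 : E 0 = 0 := by rw [hEe.self_of_nhds, he.map_zero]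
  let P : ℝ × Plane → ℝ × Plane := fun q => (q.1, E q.2)
  have hP : ContDiff ℝ ∞ P := contDiff_fst.prodMk (hE.comp contDiff_snd)
  let l : ℝ × Plane → ℝ := fun q => β (P q) * ζ (K (P q))
  have hl : ContDiff ℝ ∞ l := (hβ.comp hP).mul (hζ.comp (hK.comp hP))
  refine ⟨fun z => ∫ t in (0 : ℝ)..1, l (t, z), contDiff_integral_zero_one hl, ?_⟩
  obtain ⟨M, hM⟩ := (isCompact_Icc.prod (isCompact_closedBall (0 : Plane) 1)).exists_bound_of_continuousOn
    (hl.continuous.continuousOn (s := Icc (0 : ℝ) 1 ×ˢ Metric.closedBall (0 : Plane) 1))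
  obtain ⟨ρ, hρ, Γ, hΓ⟩ := exists_isSmoothFlow hG hG0 (|M| + 1)
  -- the path stays where `ζ` is the inverse of `η`
  obtain ⟨N, hN, hNo, h0N⟩ := eventually_nhds_iff.1
    (hζe.and (e.open_target.mem_nhds he.zero_mem_target))
  obtain ⟨A, B, -, hB, hA, hB0, hAB⟩ := generalized_tube_lemma
    (isCompact_Icc (a := (0 : ℝ)) (b := 1)) (isCompact_singleton (x := (0 : Plane)))
    (hNo.preimage (hK.comp hP).continuous) (by
      rintro ⟨t, z⟩ ⟨ht, hz⟩
      obtain rfl : z = 0 := hz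
      change K (t, E 0) ∈ N
      rw [hE0, hKt]
      exact h0N)
  have hEt : Tendsto E (𝓝 0) (𝓝 0) := by simpa [hE0] using hE.continuous.tendsto 0
  filter_upwards [hEe, e.open_source.mem_nhds he.zero_mem, hEt.eventually hode,
    hB.mem_nhds (hB0 rfl), Metric.ball_mem_nhds (0 : Plane) hρ,
    Metric.closedBall_mem_nhds (0 : Plane) one_pos] with z hzE hzs hz hzB hzρ hz1
  rw [hzE] at hz
  have hKN : ∀ t ∈ Icc (0 : ℝ) 1, K (t, e z) ∈ N := by
    intro t ht
    rw [← hzE]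
    exact hAB (show (t, z) ∈ A ×ˢ B from ⟨hA ht, hzB⟩)
  let c : ℝ → Plane := fun t => e.symm (K (t, e z))
  have hc0 : c 0 = z := by simp only [c, hK0, e.left_inv hzs]
  have hc : ∀ t ∈ Icc (0 : ℝ) 1, HasDerivWithinAt c (l (t, z) • G (c t)) (Icc 0 1) t := by
    intro t ht
    obtain ⟨hζt, htgt⟩ := hN _ (hKN t ht)
    have hcs : c t ∈ e.source := e.map_target htgt
    have hec : e (c t) = K (t, e z) := e.right_inv htgt
    have d1 := (hasFDerivAt_chart_symm he htgt).comp_hasDerivAt t (hz t ht)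
    refine (d1.congr_deriv ?_).hasDerivWithinAt
    have h1 : hamiltonian g (K (t, e z)) = (η (c t))⁻¹ • fderiv ℝ e (c t) (G (c t)) := by
      rw [hstar _ hcs, smul_smul, inv_mul_cancel₀ (hη0 _), one_smul, hec]
    have h2 : l (t, z) = β (t, e z) * (η (c t))⁻¹ := by
      simp only [l, P, hzE, hζt, c]
    rw [map_smul, h1, map_smul, h2, ← hec, fderiv_chart_symm_apply he hcs, smul_smul]
  have hMt : ∀ t ∈ Icc (0 : ℝ) 1, |∫ r in (0 : ℝ)..t, l (r, z)| ≤ |M| := by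
    intro t ht
    have := intervalIntegral.norm_integral_le_of_norm_le_const (a := 0) (b := t)
      (f := fun r => l (r, z)) (C := |M|) (fun r hr => by
        rw [uIoc_of_le ht.1] at hr
        exact (hM (r, z) ⟨⟨hr.1.le, hr.2.trans ht.2⟩, hz1⟩).trans (le_abs_self M))
    refine this.trans (mul_le_of_le_one_right (abs_nonneg _) ?_)
    rw [sub_zero, abs_of_nonneg ht.1]
    exact ht.2
  have hM1 : |M| ∈ Ioo (-(|M| + 1)) (|M| + 1) := ⟨by linarith [abs_nonneg M], by linarith⟩
  have hM2 : -|M| ∈ Ioo (-(|M| + 1)) (|M| + 1) := ⟨by linarith, by linarith [abs_nonneg M]⟩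
  have hlz : Continuous fun t => l (t, z) := hl.continuous.comp (by fun_prop)
  have := flowsTo_integral hG hlz hc hMt (by rw [hc0]; exact hΓ.flowsTo _ hM1 z hzρ)
    (by rw [hc0]; exact hΓ.flowsTo _ hM2 z hzρ)
  rwa [hc0] at this

end Chart

/-- The end of an isotopy along orbits is a shift along trajectories by a smooth function. -/
theorem exists_shift_of_mem_identityComponent {G : Plane → Plane} (hG : ContDiff ℝ ∞ G)
    (hstar : HasPropertyStar G) {h : Plane → Plane}
    (hh : (h : MapGerm) ∈ identityComponent G) :
    ∃ α : Plane → ℝ, ContDiff ℝ ∞ α ∧ ∀ᶠ z in 𝓝 (0 : Plane), FlowsTo G z (α z) (h z) := by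
  obtain ⟨η, e, n, g, hη, hη0, he, hn, hg, hsq, hstar⟩ := hstar
  obtain ⟨V, H, hV, h0V, hHt, hHc, hHd, hid, hh1⟩ := hh
  have hG0 := apply_zero_of_star hn hg he hstar
  have hH0 : ∀ t ∈ Icc (0 : ℝ) 1, H t 0 = 0 := by
    intro t ht
    obtain ⟨⟨f, hHf, ⟨e', he', hfe'⟩, -⟩, -⟩ := hHt t ht
    rw [(Germ.coe_eq.1 hHf).self_of_nhds, hfe'.self_of_nhds, he'.map_zero]
  have hfi := firstIntegral_isotopy hG he hstar hV h0V hH0 (fun t ht => (hHt t ht).2.2) hHc hid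
  let k : ℝ → Plane → Plane := fun t z => e (H t (e.symm z))
  let L : ℝ → Plane →L[ℝ] Plane := fun t =>
    (fderiv ℝ e 0).comp ((fderiv ℝ (H t) 0).comp (fderiv ℝ e.symm 0))
  have hs0 := he.symm_zero
  have hk0 : ∀ t ∈ Icc (0 : ℝ) 1, k t 0 = 0 := fun t ht => by
    simp only [k, hs0, hH0 t ht, he.map_zero]
  have hkL : ∀ t ∈ Icc (0 : ℝ) 1, HasFDerivAt (k t) (L t) 0 := by
    intro t ht
    have d1 : HasFDerivAt e.symm (fderiv ℝ e.symm 0) 0 :=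
      hasFDerivAt_chart_symm he he.zero_mem_target
    have d2 : HasFDerivAt (H t) (fderiv ℝ (H t) 0) (e.symm 0) := by
      rw [hs0]
      exact (((hHt t ht).2.1.contDiffAt (hV.mem_nhds h0V)).differentiableAt (by simp)).hasFDerivAt
    have d3 : HasFDerivAt e (fderiv ℝ e 0) (H t (e.symm 0)) := by
      rw [hs0, hH0 t ht]
      exact hasFDerivAt_chart he he.zero_mem
    exact HasFDerivAt.comp (g := e) (f := fun z => H t (e.symm z)) 0 d3
      (HasFDerivAt.comp (g := H t) (f := e.symm) 0 d2 d1)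
  have hst : Tendsto e.symm (𝓝 0) (𝓝 0) := by
    have := (e.symm.continuousAt he.zero_mem_target).tendsto
    rwa [hs0] at this
  have hgk : ∀ t ∈ Icc (0 : ℝ) 1, ∀ᶠ z in 𝓝 (0 : Plane), polyFun g (k t z) = polyFun g z := by
    intro t ht
    filter_upwards [hst.eventually hfi, e.open_target.mem_nhds he.zero_mem_target] with z hz hzt
    have := (hz t ht).2
    rwa [e.right_inv hzt] at this
  have hLc : ContinuousOn L (Icc 0 1) := by
    have h1 : ContinuousOn (fun t => fderiv ℝ (H t) 0) (Icc 0 1) :=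
      hHd.comp (f := fun t : ℝ => (t, (0 : Plane))) (by fun_prop) fun t ht => ⟨ht, h0V⟩
    exact continuousOn_const.clm_comp (h1.clm_comp continuousOn_const)
  have hL0 : L 0 = ContinuousLinearMap.id ℝ Plane := by
    have h1 : fderiv ℝ (H 0) 0 = ContinuousLinearMap.id ℝ Plane :=
      ((hasFDerivAt_id (0 : Plane)).congr_of_eventuallyEq
        (by filter_upwards [hV.mem_nhds h0V] with z hz using hid z hz)).fderiv
    refine ContinuousLinearMap.ext fun w => ?_
    have h2 := fderiv_chart_apply_symm he he.zero_mem w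
    rw [he.map_zero] at h2
    simp only [L, h1]
    exact h2
  -- a globally smooth representative of the germ of the end of the isotopy in the chart
  have hk1 : ∃ k1 : Plane → Plane, ContDiff ℝ ∞ k1 ∧ k1 =ᶠ[𝓝 0] k 1 := by
    have h1 : (1 : ℝ) ∈ Icc (0 : ℝ) 1 := by simp
    have hHs := (hHt 1 h1).2.1
    let W := V ∩ H 1 ⁻¹' e.source
    have hW : IsOpen W := hHs.continuousOn.isOpen_inter_preimage hV e.open_source
    have hU : IsOpen (e.target ∩ e.symm ⁻¹' W) := e.symm.isOpen_inter_preimage hW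
    refine exists_contDiff_eventuallyEq hU (f := k 1) ?_ ⟨he.zero_mem_target, ?_⟩
    · refine he.smooth.comp (hHs.comp (he.smooth_symm.mono inter_subset_left) ?_) ?_
      · exact fun z hz => hz.2.1
      · exact fun z hz => hz.2.2
    · rw [mem_preimage, hs0]
      refine ⟨h0V, ?_⟩
      rw [mem_preimage, hH0 1 h1]
      exact he.zero_mem
  obtain ⟨k1, hk1s, hk1e⟩ := hk1
  have h1 : (1 : ℝ) ∈ Icc (0 : ℝ) 1 := by simp
  obtain ⟨K, β, hK, hβ, hKt, hK0, hK1, hode⟩ := exists_hamiltonian_path hn hg hsq hk1s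
    (by rw [hk1e.self_of_nhds, hk0 1 h1])
    (by filter_upwards [hgk 1 h1, hk1e] with z hz hz'; rw [hz', hz]) hLc hL0
    ((hkL 1 h1).congr_of_eventuallyEq hk1e)
    (fun t ht z => polyFun_linear_part hg (hk0 t ht) (hkL t ht) (hgk t ht) z)
  obtain ⟨τ, hτ, hτf⟩ := exists_shift_of_path hG hG0 hη hη0 he hstar hK hβ hKt hK0 hode
  refine ⟨τ, hτ, ?_⟩
  have het : Tendsto e (𝓝 0) (𝓝 0) := by
    have := (e.continuousAt he.zero_mem).tendsto
    rwa [he.map_zero] at this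
  filter_upwards [hτf, het.eventually hk1e, e.open_source.mem_nhds he.zero_mem, hfi,
    Germ.coe_eq.1 hh1] with z hz hz1 hzs hzfi hzh
  rw [hK1, hz1] at hz
  simp only [k, e.left_inv hzs, e.left_inv (hzfi 1 h1).1] at hz
  rwa [hzh]

end ShiftGerms

theorem theorem1p6 (G : ShiftGerms.Plane → ShiftGerms.Plane) (hG : ContDiff ℝ ∞ G)
    (hstar : ShiftGerms.HasPropertyStar G) :
    ShiftGerms.shiftGerms G = ShiftGerms.identityComponent G ∧
    ∀ h : ShiftGerms.Plane → ShiftGerms.Plane,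
      (h : ShiftGerms.MapGerm) ∈ ShiftGerms.identityComponent G →
      ∃ α : ShiftGerms.Plane → ℝ, ContDiff ℝ ∞ α ∧
        ∀ᶠ z in 𝓝 (0 : ShiftGerms.Plane), ShiftGerms.FlowsTo G z (α z) (h z) := by
  have key := fun (h : ShiftGerms.Plane → ShiftGerms.Plane) hh =>
    ShiftGerms.exists_shift_of_mem_identityComponent hG hstar (h := h) hh
  refine ⟨Subset.antisymm ?_ fun h => ?_, key⟩
  · obtain ⟨η, e, n, g, -, -, he, hn, hg, -, hstar⟩ := hstar
    exact ShiftGerms.shiftGerms_subset_identityComponent hG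
      (ShiftGerms.apply_zero_of_star hn hg he hstar)
  · induction h using Filter.Germ.inductionOn with
    | _ f =>
      intro hf
      obtain ⟨α, hα, hfα⟩ := key f hf
      exact ⟨f, α, rfl, ⟨univ, isOpen_univ, mem_univ 0, hα.contDiffOn⟩, hfα⟩
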